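/- All matroids are finite. For a matroid $M$ with ground set $E(M)$ and rank function $r$, let $\lambda_M(X)=r(X)+r(E(M)-X)-r(E(M))$. A partition $(X,Y)$ of $E(M)$ is a $k$-separation if $\lambda_M(X)<k$ and $|X|,|Y|\ge k$; $M$ is $3$-connected if it has no $k$-separation with $k<3$. $M$ has an $N$-minor if some minor of $M$ is isomorphic to $N$. $\mathrm{si}(M)$ is obtained from $M$ by deleting all loops and all but one element of each parallel class, and $\mathrm{cl}$ denotes closure in $M$. A four-element fan of $M$ is a sequence $(x_1,x_2,x_3,x_4)$ of distinct elements such that $\{x_1,x_2,x_3\}$ is a circuit and $\{x_2,x_3,x_4\}$ is a cocircuit. A segment of $M$ is a set $L$ with $|L|\ge 3$ all of whose three-element subsets are circuits. A segment-cosegment pair of $M$ is a pair $(L,L^*)$ where $L=\{x_1,\dots,x_t\}$ is a segment of $M$ and $L^*=\{y_1,\dots,y_t\}$ is a set, where $x_1,\dots,x_t$ are distinct and $y_1,\dots,y_t$ are distinct, such that $L\cap L^*=\emptyset$ and $(\mathrm{cl}(L)-\{x_i\})\cup\{y_i\}$ is a cocircuit of $M$ for every $i$. A spore of a matroid is a pair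 $(P,s)$ such that $P$ is a rank-one flat, $s$ is an element, and $P\cup\{s\}$ is a cocircuit. A matroid is $3$-connected up to a unique spore $(P,s)$ if $(P,s)$ is its only spore and, whenever $(X,Y)$ is a $k$-separation of it for some $k<3$, either $X\subseteq P\cup\{s\}$ or $Y\subseteq P\cup\{s\}$. Theorem. Let $M$ and $N$ be $3$-connected matroids with $|E(N)|\ge 4$, and let $C^*$ be a cocircuit of $M$ such that $M/x_0$ has an $N$-minor for some $x_0\in C^*$. Then at least one of the following holds: (i) there is an element $x\in C^*$ such that $\mathrm{si}(M/x)$ is $3$-connected and has an $N$-minor; (ii) there is a four-element fan $(x_1,x_2,x_3,x_4)$ of $M$ such that $x_1,x_3\in C^*$ and $\mathrm{si}(M/x_2)$ is $3$-connected with an $N$-minor; (iii) there is a segment-cosegment pair $(L,L^*)$ of $M$, with $L=\{x_1,\dots,x_t\}$ and $L^*=\{y_1,\dots,y_t\}$ indexed as above, such that $L\subseteq C^*$; $\mathrm{cl}(L)-L=\{e\}$ for a single element $e$, where $e\notin C^*$ and $\mathrm{si}(M/e)$ is $3$-connected with an $N$-minor; $M/\mathrm{cl}(L)$ is $3$-connected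 with an $N$-minor; and, for every $i$, $M/x_i$ is $3$-connected up to a unique spore $(\mathrm{cl}(L)-\{x_i\},\,y_i)$; (iv) there is a segment-cosegment pair $(L,L^*)$ of $M$, with $L=\{x_1,\dots,x_t\}$ and $L^*=\{y_1,\dots,y_t\}$ indexed as above, such that $L$ is a flat of $M$; $|L-C^*|\le 1$; $M/L$ is $3$-connected with an $N$-minor; and, for every $i$, $M/x_i$ is $3$-connected up to a unique spore $(L-\{x_i\},\,y_i)$. -/

import Mathlib

open Set
open scoped Matroid

namespace Matroid

variable {α β : Type*}

/-- The rank of a set in a finite matroid, as a natural number. -/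
noncomputable def finRk (M : Matroid α) (X : Set α) : ℕ := (M.eRk X).toNat

/-- The connectivity function `λ(X) = r(X) + r(E - X) - r(M)` of a finite matroid. -/
noncomputable def conn (M : Matroid α) (X : Set α) : ℤ :=
  (M.finRk X : ℤ) + M.finRk (M.E \ X) - M.finRk M.E

/-- `(X, Y)` is a `k`-separation of `M`: a partition of the ground set with `λ(X) < k` and both
sides of size at least `k`. -/
structure IsKSeparation (M : Matroid α) (k : ℕ) (X Y : Set α) : Prop where
  disjoint : Disjoint X Y
  union_eq : X ∪ Y = M.E
  conn_lt : M.conn X < k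
  left_card : (k : ℕ∞) ≤ X.encard
  right_card : (k : ℕ∞) ≤ Y.encard

/-- `M` is `n`-connected if it has no `k`-separation with `k < n`. -/
def NConnected (M : Matroid α) (n : ℕ) : Prop :=
  ∀ k < n, ∀ X Y, ¬ M.IsKSeparation k X Y

/-- `M` has an `N`-minor: some minor of `M` is isomorphic to `N`. -/
def HasMinor (M : Matroid α) (N : Matroid β) : Prop :=
  ∃ (f : β → α) (hf : InjOn f N.E), N.map f hf ≤m M

/-- A chosen element with the same closure as `e`. For a nonloop `e` this is a chosen
representative of the parallel class of `e`; it depends only on that class. -/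
noncomputable def parallelRep (M : Matroid α) (e : α) : α :=
  Classical.choose (⟨e, rfl⟩ : ∃ f, M.closure {f} = M.closure {e})

/-- The simple matroid `si(M)` associated with `M`: all loops are deleted, and all elements but one
chosen representative of each parallel class. -/
noncomputable def si (M : Matroid α) : Matroid α :=
  M ↾ {e | M.IsNonloop e ∧ M.parallelRep e = e}

lemma closure_parallelRep (M : Matroid α) (e : α) :
    M.closure {M.parallelRep e} = M.closure {e} :=
  Classical.choose_spec (⟨e, rfl⟩ : ∃ f, M.closure {f} = M.closure {e})

lemma parallelRep_congr {M : Matroid α} {e f : α} (h : M.closure {e} = M.closure {f}) :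
    M.parallelRep e = M.parallelRep f := by
  simp only [parallelRep, h]

/-- The ground set of `si(M)` consists of nonloops and meets each parallel class exactly once. -/
lemma existsUnique_mem_si (M : Matroid α) {e : α} (he : M.IsNonloop e) :
    ∃! f, f ∈ M.si.E ∧ M.closure {f} = M.closure {e} := by
  have hcl := M.closure_parallelRep e
  have hnl : M.IsNonloop (M.parallelRep e) := by
    have hmem : e ∈ M.closure {M.parallelRep e} := by
      rw [hcl]; exact M.mem_closure_of_mem rfl (by simpa using he.mem_ground)
    have hE : M.parallelRep e ∈ M.E := by
      by_contra hE
      have h0 : M.closure {M.parallelRep e} = M.loops := by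
        rw [← M.closure_inter_ground, singleton_inter_eq_empty.2 hE, loops]
      rw [h0] at hmem
      exact he.not_isLoop hmem
    rw [← M.not_isLoop_iff hE]
    intro hl
    rw [hl.closure] at hmem
    exact he.not_isLoop hmem
  refine ⟨M.parallelRep e, ⟨⟨hnl, parallelRep_congr hcl⟩, hcl⟩, ?_⟩
  rintro f ⟨⟨-, hf⟩, hfe⟩
  rw [← hf, parallelRep_congr hfe]

/-- A triangle is a three-element circuit. -/
def IsTriangle (M : Matroid α) (T : Set α) : Prop := M.IsCircuit T ∧ T.encard = 3

/-- A triad is a three-element cocircuit. -/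
def IsTriad (M : Matroid α) (T : Set α) : Prop := M.IsCocircuit T ∧ T.encard = 3

/-- `(x₁, x₂, x₃, x₄)` is a four-element fan. -/
def IsFourFan (M : Matroid α) (x₁ x₂ x₃ x₄ : α) : Prop :=
  [x₁, x₂, x₃, x₄].Nodup ∧ M.IsTriangle {x₁, x₂, x₃} ∧ M.IsTriad {x₂, x₃, x₄}

/-- A segment: at least three elements, every three-element subset being a triangle. -/
def IsSegment (M : Matroid α) (L : Set α) : Prop :=
  3 ≤ L.encard ∧ ∀ T ⊆ L, T.encard = 3 → M.IsTriangle T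

/-- `(L, K)` is a segment-cosegment pair of `M`, where `y` is the indexing that sends the element
`xᵢ` of `L` to the corresponding element `yᵢ` of `K`. -/
structure IsSegmentCosegmentPair (M : Matroid α) (L K : Set α) (y : α → α) : Prop where
  isSegment : M.IsSegment L
  bijOn : BijOn y L K
  disjoint : Disjoint L K
  isCocircuit : ∀ x ∈ L, M.IsCocircuit ((M.closure L \ {x}) ∪ {y x})

/-- `(P, s)` is a spore: `P` is a rank-one flat and `P ∪ s` is a cocircuit. -/
def IsSpore (M : Matroid α) (P : Set α) (s : α) : Prop :=
  M.IsFlat P ∧ M.eRk P = 1 ∧ s ∈ M.E ∧ M.IsCocircuit (P ∪ {s})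

/-- `M` is 3-connected up to the unique spore `(P, s)`. -/
structure ConnectedUpToUniqueSpore (M : Matroid α) (P : Set α) (s : α) : Prop where
  isSpore : M.IsSpore P s
  unique : ∀ P' s', M.IsSpore P' s' → P' = P ∧ s' = s
  separation : ∀ k < 3, ∀ X Y, M.IsKSeparation k X Y → X ⊆ P ∪ {s} ∨ Y ⊆ P ∪ {s}

end Matroid

set_option linter.unusedSectionVars false

namespace Matroid

variable {α β : Type*}

/-! ### Rank as a natural number: submodularity, contraction, cocircuits. -/

section finRk

variable {M : Matroid α} [M.RankFinite] {X Y A B : Set α} {e f : α}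

/-! Suppose (i) fails. A separation of si(M/x) fattens to a separation of M, so every x in C for
which M/x keeps an N-minor is the guts of a vertical 3-partition (X, x, Y)
(`NConnected.exists_isVerticalPartition`). Since N is 3-connected, it sits on one side of this
partition up to at most one element. Among all vertical 3-partitions with guts z in C whose side Y
meets some N-minor in at most one element, choose one with Y ∪ z minimal. Minimality keeps the
elements of Y out of the closure of X, and the 2-sum structure of M/z then allows each of them to be
contracted with N preserved (`IsRankMinor.exists_contract`). Hence every element of C ∩ Y is again
the guts of a vertical 3-partition.

Uncrossing these partitions against the minimal one forces a long line L inside Y ∪ z, a point x of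
L in C, and a lobe at x: an element t for which L - x ∪ t is a cocircuit
(`IsMinimalPartition.exists_isLobe`). The lobe gives a 2-separation of M/x with N concentrated away
from L, so M/L has an N-minor (`IsLobe.exists_isRankMinor`).

Lobes spread: given one at x, any two further points of L that are guts of vertical 3-partitions
have lobes too (`IsLobe.lobes`). Once three points have lobes, M/L is 3-connected, and each M/x with
x one of these points is 3-connected up to a unique spore (`HasLobes.nConnected_contract`,
`HasLobes.connectedUpToUniqueSpore`).

Since C is a cocircuit meeting L, at most one point of L lies outside C. If all points of L are guts
of vertical 3-partitions, (iv) holds. Otherwise the exception is a single point e outside C with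
si(M/e) 3-connected. Then (iii) holds if L - e has at least three points, and otherwise the triangle
L and the lobe at x form the fan of (ii).

Throughout, minors are encoded by rank equations (`IsRankMinor`), so each crossing argument becomes
a sum of submodular inequalities. -/

lemma cast_finRk (M : Matroid α) [M.RankFinite] (X : Set α) : (M.finRk X : ℕ∞) = M.eRk X :=
  ENat.natCast_toNat (eRk_ne_top_iff.2 (M.isRkFinite_set X))

lemma finRk_mono (M : Matroid α) [M.RankFinite] (h : X ⊆ Y) : M.finRk X ≤ M.finRk Y := by
  have := M.eRk_mono h
  rw [← cast_finRk, ← cast_finRk] at this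
  exact_mod_cast this

/-- Allowing any `U` below the union and any `I` below the intersection means that applications need
only set inclusions, never set identities. -/
lemma finRk_submod (M : Matroid α) [M.RankFinite] {U I : Set α} (hU : U ⊆ A ∪ B) (hIA : I ⊆ A)
    (hIB : I ⊆ B) : M.finRk U + M.finRk I ≤ M.finRk A + M.finRk B := by
  have h := M.eRk_inter_add_eRk_union_le A B
  simp only [← cast_finRk] at h
  have h' : M.finRk (A ∩ B) + M.finRk (A ∪ B) ≤ M.finRk A + M.finRk B := by exact_mod_cast h
  have := M.finRk_mono hU
  have := M.finRk_mono (subset_inter hIA hIB)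
  omega

@[simp] lemma finRk_empty (M : Matroid α) : M.finRk ∅ = 0 := by simp [finRk]

lemma finRk_inter_ground (M : Matroid α) (X : Set α) : M.finRk (X ∩ M.E) = M.finRk X := by
  simp [finRk]

lemma finRk_le_ground (M : Matroid α) [M.RankFinite] (X : Set α) :
    M.finRk X ≤ M.finRk M.E := by
  rw [← finRk_inter_ground]
  exact M.finRk_mono inter_subset_right

@[simp] lemma finRk_closure (M : Matroid α) (X : Set α) : M.finRk (M.closure X) = M.finRk X := by
  simp [finRk]

lemma finRk_union_le (M : Matroid α) [M.RankFinite] (X Y : Set α) :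
    M.finRk (X ∪ Y) ≤ M.finRk X + M.finRk Y := by
  have := M.finRk_submod (subset_refl (X ∪ Y)) (empty_subset _) (empty_subset _)
  simpa using this

lemma finRk_singleton_le (M : Matroid α) [M.RankFinite] (e : α) : M.finRk {e} ≤ 1 := by
  have := M.eRk_singleton_le e
  rw [← cast_finRk] at this
  exact_mod_cast this

lemma finRk_insert_le (M : Matroid α) [M.RankFinite] (e : α) (X : Set α) :
    M.finRk (insert e X) ≤ M.finRk X + 1 := by
  have := M.finRk_union_le {e} X
  have := M.finRk_singleton_le e
  rw [insert_eq]
  omega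

lemma finRk_le_encard (M : Matroid α) [M.RankFinite] (X : Set α) :
    (M.finRk X : ℕ∞) ≤ X.encard := by
  rw [cast_finRk]; exact M.eRk_le_encard X

lemma finRk_insert_eq_of_subset (M : Matroid α) [M.RankFinite] (hXY : X ⊆ Y)
    (h : M.finRk (insert e X) = M.finRk X) : M.finRk (insert e Y) = M.finRk Y := by
  have := M.finRk_submod (A := insert e X) (B := Y) (U := insert e Y) (I := X)
    (by intro x; simp; tauto) (subset_insert _ _) hXY
  have := M.finRk_mono (subset_insert e Y)
  omega

lemma finRk_union_eq_of_forall (M : Matroid α) [M.Finite]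
    (h : ∀ e ∈ Y, M.finRk (insert e X) = M.finRk X) : M.finRk (X ∪ Y) = M.finRk X := by
  have hcl : ∀ e ∈ Y ∩ M.E, e ∈ M.closure X := by
    intro e he
    by_contra hcon
    have h1 := M.eRk_insert_eq_add_one (e := e) (X := X) ⟨he.2, hcon⟩
    rw [← cast_finRk, ← cast_finRk, h e he.1] at h1
    have : M.finRk X = M.finRk X + 1 := by exact_mod_cast h1
    omega
  apply le_antisymm _ (M.finRk_mono subset_union_left)
  rw [← finRk_closure _ X, ← finRk_inter_ground]
  apply finRk_mono
  rintro e ⟨he | he, heE⟩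
  · exact M.mem_closure_of_mem' he heE
  · exact hcl e ⟨he, heE⟩

lemma mem_closure_iff_finRk (heE : e ∈ M.E) :
    e ∈ M.closure X ↔ M.finRk (insert e X) = M.finRk X := by
  constructor
  · intro h
    apply le_antisymm _ (M.finRk_mono (subset_insert e X))
    rw [← finRk_closure _ X, ← finRk_inter_ground]
    apply finRk_mono
    rintro f ⟨rfl | hf, hfE⟩
    · exact h
    · exact M.mem_closure_of_mem' hf hfE
  · intro h
    by_contra hcon
    have h1 := M.eRk_insert_eq_add_one (e := e) (X := X) ⟨heE, hcon⟩
    rw [← cast_finRk, ← cast_finRk, h] at h1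
    have : M.finRk X = M.finRk X + 1 := by exact_mod_cast h1
    omega

lemma finRk_restrict (M : Matroid α) (R X : Set α) : (M ↾ R).finRk X = M.finRk (X ∩ R) := by
  simp only [finRk, restrict_eRk_eq']

lemma finRk_map (N : Matroid β) {f : β → α} (hf : InjOn f N.E) {Z : Set β} (hZ : Z ⊆ N.E) :
    (N.map f hf).finRk (f '' Z) = N.finRk Z := by
  simp only [finRk, eRk_map N hf hZ]

/-- A basis of `C` extends to one of `X ∪ C`, and the added part is a basis in the contraction. The
additive form avoids truncated subtraction. -/
lemma finRk_contract (M : Matroid α) [M.RankFinite] (C X : Set α) :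
    (M ／ C).finRk X + M.finRk C = M.finRk (X ∪ C) := by
  obtain ⟨I, hI⟩ := M.exists_isBasis' C
  obtain ⟨J, hJ, hIJ⟩ := hI.indep.subset_isBasis'_of_subset
    (hI.subset.trans (subset_union_right (s := X)))
  have hJC : J ∩ C = I :=
    (hI.eq_of_subset_indep (hJ.indep.subset inter_subset_left) (subset_inter hIJ hI.subset)
      inter_subset_right).symm
  have hb := hJ.contract_isBasis' hI (hJ.indep.subset (union_subset sdiff_subset hIJ))
  have h1 : (M ／ C).eRk X = (J \ C).encard := by
    rw [hb.encard_eq_eRk, ← eRk_inter_ground, ← eRk_inter_ground _ ((X ∪ C) \ C)]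
    congr 1
    ext x; simp; tauto
  have h2 : (J \ C).encard + I.encard = J.encard := by
    rw [← hJC]; exact encard_sdiff_add_encard_inter J C
  rw [← h1, hI.encard_eq_eRk, hJ.encard_eq_eRk] at h2
  simp only [← cast_finRk] at h2
  exact_mod_cast h2

lemma indep_iff_finRk (hfin : X.Finite) : M.Indep X ↔ M.finRk X = X.ncard := by
  rw [indep_iff_eRk_eq_encard_of_finite hfin, ← cast_finRk, ← hfin.cast_ncard_eq]
  norm_cast

lemma ext_finRk {M₁ M₂ : Matroid α} [M₁.Finite] [M₂.Finite] (hE : M₁.E = M₂.E)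
    (h : ∀ X ⊆ M₁.E, M₁.finRk X = M₂.finRk X) : M₁ = M₂ := by
  refine ext_indep hE fun I hI ↦ ?_
  have hfin := M₁.ground_finite.subset hI
  rw [indep_iff_finRk hfin, indep_iff_finRk hfin, h I hI]

lemma spanning_iff_finRk (hX : X ⊆ M.E) : M.Spanning X ↔ M.finRk X = M.finRk M.E := by
  rw [spanning_iff_eRk_le hX, ← eRk_ground, ← cast_finRk, ← cast_finRk, Nat.cast_le]
  have := M.finRk_mono hX
  omega

/-- Cocircuits are the complements of hyperplanes; this rank form is how lobes are both recognised
and used. -/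
lemma isCocircuit_iff_finRk {D : Set α} (hD : D ⊆ M.E) :
    M.IsCocircuit D ↔ M.finRk (M.E \ D) + 1 = M.finRk M.E ∧
      ∀ d ∈ D, M.finRk (insert d (M.E \ D)) = M.finRk M.E := by
  rw [isCocircuit_iff_minimal_compl_nonspanning']
  constructor
  · intro h
    have h2 : ∀ d ∈ D, M.finRk (insert d (M.E \ D)) = M.finRk M.E := by
      intro d hd
      by_contra hcon
      have h3 := h.2 (y := D \ {d}) ⟨?_, sdiff_subset.trans hD⟩ sdiff_subset hd
      · simp at h3
      · rw [spanning_iff_finRk sdiff_subset]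
        convert hcon using 3
        ext x; simp; have : x = d → x ∈ M.E := by rintro rfl; exact hD hd
        tauto
    refine ⟨?_, h2⟩
    have h1 := h.1.1
    rw [spanning_iff_finRk sdiff_subset] at h1
    obtain hemp | ⟨d, hd⟩ := D.eq_empty_or_nonempty
    · simp [hemp] at h1
    have := h2 d hd
    have := M.finRk_insert_le d (M.E \ D)
    have := M.finRk_mono (sdiff_subset (s := M.E) (t := D))
    omega
  · rintro ⟨h1, h2⟩
    refine ⟨⟨?_, hD⟩, ?_⟩
    · rw [spanning_iff_finRk sdiff_subset]; omega
    · rintro Y ⟨hY, hYE⟩ hYD d hd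
      by_contra hdY
      rw [spanning_iff_finRk sdiff_subset] at hY
      have := h2 d hd
      have h3 : insert d (M.E \ D) ⊆ M.E \ Y := by
        rintro x (rfl | hx)
        · exact ⟨hD hd, hdY⟩
        · exact ⟨hx.1, fun h ↦ hx.2 (hYD h)⟩
      have := M.finRk_mono h3
      have := M.finRk_le_ground (M.E \ Y)
      omega

/-- An element of a cocircuit is not spanned by a set that avoids the cocircuit. -/
lemma IsCocircuit.finRk_insert {D : Set α} (hD : M.IsCocircuit D) (he : e ∈ D)
    (hX : Disjoint X D) : M.finRk (insert e X) = M.finRk X + 1 := by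
  obtain ⟨h1, h2⟩ := (isCocircuit_iff_finRk hD.subset_ground).1 hD
  have h3 := h2 e he
  have := M.finRk_insert_le e X
  have := M.finRk_mono (subset_insert e X)
  by_contra hcon
  have h4 := M.finRk_insert_eq_of_subset (e := e) (X := X ∩ M.E) (Y := M.E \ D) ?_ ?_
  · omega
  · exact fun x hx ↦ ⟨hx.2, disjoint_left.1 hX hx.1⟩
  · have : M.finRk (insert e (X ∩ M.E)) = M.finRk (insert e X) := by
      rw [← finRk_inter_ground _ (insert e X), insert_inter_of_mem (hD.subset_ground he)]
    rw [finRk_inter_ground]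
    omega

end finRk

lemma two_le_encard_iff_nontrivial {s : Set α} : 2 ≤ s.encard ↔ s.Nontrivial := by
  rw [← one_lt_encard_iff_nontrivial, ← one_add_one_eq_two]
  exact Order.add_one_le_iff_of_not_isMax (by simp)

/-! ### Rank consequences of 3-connectivity. -/

section threeConnected

variable {M : Matroid α} [M.RankFinite] {A B : Set α} {e f : α}

/-- This is the absence of 2-separations. Letting `B` be any superset of the complement spares an
exact computation of the complement. -/
lemma NConnected.add_le_finRk_add_finRk (hM : M.NConnected 3) (hA : A ⊆ M.E) (hB : M.E \ A ⊆ B)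
    (hAn : A.Nontrivial) (hBn : (M.E \ A).Nontrivial) :
    M.finRk M.E + 2 ≤ M.finRk A + M.finRk B := by
  have h := hM 2 (by norm_num) A (M.E \ A)
  by_contra hcon
  refine h ⟨disjoint_sdiff_right, union_sdiff_cancel hA, ?_, ?_, ?_⟩
  · have := M.finRk_mono hB
    simp only [conn]
    omega
  · exact_mod_cast two_le_encard_iff_nontrivial.2 hAn
  · exact_mod_cast two_le_encard_iff_nontrivial.2 hBn

lemma sdiff_pair_nontrivial {E : Set α} (h4 : 4 ≤ E.encard) (e f : α) :
    (E \ {e, f}).Nontrivial := by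
  rw [← two_le_encard_iff_nontrivial]
  have h1 := E.encard_sdiff_add_encard_inter {e, f}
  have h2 : (E ∩ {e, f}).encard ≤ 2 := (encard_le_encard inter_subset_right).trans
    ((encard_insert_le _ _).trans (by rw [encard_singleton, one_add_one_eq_two]))
  by_contra! hcon
  have h3 : (E \ {e, f}).encard ≤ 1 := Order.le_of_lt_add_one (by simpa [one_add_one_eq_two] using hcon)
  have := add_le_add h3 h2
  rw [h1] at this
  have := h4.trans this
  norm_num at this

lemma NConnected.finRk_singleton_and (hM : M.NConnected 3) (h4 : 4 ≤ M.E.encard) (he : e ∈ M.E) :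
    M.finRk {e} = 1 ∧ M.finRk (M.E \ {e}) = M.finRk M.E := by
  have h := hM 1 (by norm_num) {e} (M.E \ {e})
  have h1 := M.finRk_singleton_le e
  have h2 := M.finRk_le_ground (M.E \ {e})
  by_contra hcon
  refine h ⟨disjoint_sdiff_right, union_sdiff_cancel (by simpa), ?_, by simp, ?_⟩
  · simp only [conn]
    omega
  · rw [Nat.cast_one, one_le_encard_iff_nonempty]
    simpa using (sdiff_pair_nontrivial h4 e e).nonempty

lemma NConnected.finRk_singleton (hM : M.NConnected 3) (h4 : 4 ≤ M.E.encard) (he : e ∈ M.E) :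
    M.finRk {e} = 1 := (hM.finRk_singleton_and h4 he).1

lemma NConnected.finRk_compl_singleton (hM : M.NConnected 3) (h4 : 4 ≤ M.E.encard)
    (he : e ∈ M.E) : M.finRk (M.E \ {e}) = M.finRk M.E := (hM.finRk_singleton_and h4 he).2

lemma NConnected.finRk_pair_and (hM : M.NConnected 3) (h4 : 4 ≤ M.E.encard) (he : e ∈ M.E)
    (hf : f ∈ M.E) (hef : e ≠ f) :
    M.finRk {e, f} = 2 ∧ M.finRk (M.E \ {e, f}) = M.finRk M.E := by
  have h := hM.add_le_finRk_add_finRk (pair_subset he hf) (subset_refl _) (nontrivial_pair hef)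
    (sdiff_pair_nontrivial h4 e f)
  have h1 := M.finRk_insert_le e {f}
  have h2 := M.finRk_singleton_le f
  have := M.finRk_le_ground (M.E \ {e, f})
  omega

lemma NConnected.finRk_pair (hM : M.NConnected 3) (h4 : 4 ≤ M.E.encard) (he : e ∈ M.E)
    (hf : f ∈ M.E) (hef : e ≠ f) : M.finRk {e, f} = 2 := (hM.finRk_pair_and h4 he hf hef).1

lemma NConnected.finRk_compl_pair (hM : M.NConnected 3) (h4 : 4 ≤ M.E.encard) (he : e ∈ M.E)
    (hf : f ∈ M.E) : M.finRk (M.E \ {e, f}) = M.finRk M.E := by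
  obtain rfl | hef := eq_or_ne e f
  · simpa using hM.finRk_compl_singleton h4 he
  · exact (hM.finRk_pair_and h4 he hf hef).2

/-- Every nonspanning set misses at least three elements of the ground set. -/
lemma NConnected.exists_mem_notMem (hM : M.NConnected 3) (h4 : 4 ≤ M.E.encard)
    (hA : M.finRk A < M.finRk M.E) (e f : α) : ∃ x ∈ M.E, x ∉ A ∧ x ≠ e ∧ x ≠ f := by
  by_contra! hcon
  have key : ∀ a b, a ∈ M.E → b ∈ M.E → M.E \ {a, b} ⊆ A → False := by
    intro a b ha hb h
    have := M.finRk_mono h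
    rw [hM.finRk_compl_pair h4 ha hb] at this
    omega
  obtain ⟨x, hx⟩ := (sdiff_pair_nontrivial h4 e f).nonempty
  by_cases he : e ∈ M.E <;> by_cases hf : f ∈ M.E
  · exact key e f he hf fun y hy ↦ by by_contra h; have := hcon y hy.1 h; simp at hy; tauto
  · exact key e e he he fun y hy ↦ by
      by_contra h; have := hcon y hy.1 h; simp at hy; exact hf (this hy.2 ▸ hy.1)
  · exact key f f hf hf fun y hy ↦ by
      by_contra h; have := hcon y hy.1 h; simp at hy
      exact hy.2 (this fun h ↦ he (h ▸ hy.1))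
  · exact key x x hx.1 hx.1 fun y hy ↦ by
      by_contra h; exact hf (hcon y hy.1 h (fun h ↦ he (h ▸ hy.1)) ▸ hy.1)

/-- Turns a rank bound into the cardinality hypothesis of `NConnected.add_le_finRk_add_finRk`. -/
lemma NConnected.compl_nontrivial (hM : M.NConnected 3) (h4 : 4 ≤ M.E.encard)
    (hA : M.finRk A < M.finRk M.E) : (M.E \ A).Nontrivial := by
  obtain ⟨x₀, -⟩ : M.E.Nonempty := by rw [← encard_pos]; exact lt_of_lt_of_le (by norm_num) h4
  obtain ⟨x, hx, hxA, -⟩ := hM.exists_mem_notMem h4 hA x₀ x₀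
  obtain ⟨y, hy, hyA, hyx, -⟩ := hM.exists_mem_notMem h4 hA x x₀
  exact ⟨x, ⟨hx, hxA⟩, y, ⟨hy, hyA⟩, hyx.symm⟩

end threeConnected

/-- The map `f` carries `N` to the minor of `M` obtained by contracting `I` and then restricting
to the image of `N.E`, as expressed by ranks. -/
structure IsRankMinor (M : Matroid α) (N : Matroid β) (f : β → α) (I : Set α) : Prop where
  image_subset : f '' N.E ⊆ M.E
  subset_ground : I ⊆ M.E
  finRk_eq : ∀ Z ⊆ N.E, M.finRk (f '' Z ∪ I) = N.finRk Z + M.finRk I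

/-! ### Minors through ranks. -/

section minors

variable {M : Matroid α} [M.Finite] {N : Matroid β} [N.Finite] {f : β → α} {I : Set α}

lemma HasMinor.exists_isRankMinor (h : M.HasMinor N) : ∃ f I, M.IsRankMinor N f I := by
  obtain ⟨f, hf, C, D, h⟩ := h
  -- The minor relation allows `C` to leave the ground set, whereas `IsRankMinor` does not.
  refine ⟨f, C ∩ M.E, ?_, inter_subset_right, fun Z hZ ↦ ?_⟩
  · have : (N.map f hf).E = f '' N.E := rfl
    rw [← this, h]
    exact sdiff_subset.trans sdiff_subset
  · have h1 := N.finRk_map hf hZ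
    have h2 := M.finRk_contract C (f '' Z)
    rw [h, delete_eq_restrict, finRk_restrict] at h1
    have hss : f '' Z ⊆ (M ／ C).E \ D := by
      have : (N.map f hf).E = f '' N.E := rfl
      rw [← delete_ground, ← h, this]
      exact image_mono hZ
    rw [inter_eq_self_of_subset_left hss] at h1
    rw [finRk_inter_ground, ← h1, h2, ← finRk_inter_ground, ← finRk_inter_ground _ (_ ∪ C)]
    congr 1
    generalize f '' Z = W
    ext x; simp; tauto

lemma IsRankMinor.disjoint (h : M.IsRankMinor N f I) (hN : ∀ e ∈ N.E, N.finRk {e} = 1) :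
    Disjoint I (f '' N.E) := by
  rw [disjoint_right]
  rintro _ ⟨e, he, rfl⟩ heI
  have := h.finRk_eq {e} (by simpa)
  rw [image_singleton, singleton_union, insert_eq_of_mem heI, hN e he] at this
  omega

lemma IsRankMinor.injOn (h : M.IsRankMinor N f I)
    (hN : ∀ e ∈ N.E, ∀ e' ∈ N.E, e ≠ e' → N.finRk {e, e'} = 2) : InjOn f N.E := by
  intro e he e' he' hee
  by_contra hne
  have := h.finRk_eq {e, e'} (pair_subset he he')
  rw [hN e he e' he' hne, image_pair, hee, pair_eq_singleton, singleton_union] at this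
  have := M.finRk_insert_le (f e') I
  omega

lemma IsRankMinor.hasMinor (h : M.IsRankMinor N f I) (hN1 : ∀ e ∈ N.E, N.finRk {e} = 1)
    (hN2 : ∀ e ∈ N.E, ∀ e' ∈ N.E, e ≠ e' → N.finRk {e, e'} = 2) : M.HasMinor N := by
  have hf := h.injOn hN2
  have hdj := h.disjoint hN1
  have hss : f '' N.E ⊆ (M ／ I).E := subset_sdiff.2 ⟨h.image_subset, hdj.symm⟩
  refine ⟨f, hf, I, (M ／ I).E \ f '' N.E, ?_⟩
  have : (M ／ I ＼ ((M ／ I).E \ f '' N.E)).E = f '' N.E := by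
    rw [delete_ground, sdiff_sdiff_cancel_left hss]
  refine ext_finRk this.symm fun X hX ↦ ?_
  obtain ⟨Z, hZ, rfl⟩ := subset_image_iff.1 (show X ⊆ f '' N.E from hX)
  rw [finRk_map N hf hZ, delete_eq_restrict, finRk_restrict, sdiff_sdiff_cancel_left hss,
    inter_eq_self_of_subset_left (image_mono hZ)]
  have := M.finRk_contract I (f '' Z)
  have := h.finRk_eq Z hZ
  omega

lemma IsRankMinor.of_contract {C : Set α} (hC : C ⊆ M.E) (h : (M ／ C).IsRankMinor N f I) :
    M.IsRankMinor N f (I ∪ C) := by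
  refine ⟨h.image_subset.trans sdiff_subset,
    union_subset (h.subset_ground.trans sdiff_subset) hC, fun Z hZ ↦ ?_⟩
  have h1 := h.finRk_eq Z hZ
  have h2 := M.finRk_contract C (f '' Z ∪ I)
  have h3 := M.finRk_contract C I
  rw [← union_assoc]
  omega

lemma IsRankMinor.contract {C : Set α} (h : M.IsRankMinor N f I) (hC : C ⊆ I)
    (hN1 : ∀ e ∈ N.E, N.finRk {e} = 1) : (M ／ C).IsRankMinor N f (I \ C) := by
  refine ⟨subset_sdiff.2 ⟨h.image_subset, ((h.disjoint hN1).mono_left hC).symm⟩,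
    sdiff_subset_sdiff_left h.subset_ground, fun Z hZ ↦ ?_⟩
  have h1 := h.finRk_eq Z hZ
  have h2 := M.finRk_contract C (f '' Z ∪ I \ C)
  have h3 := M.finRk_contract C (I \ C)
  rw [union_assoc, sdiff_union_of_subset hC] at h2
  rw [sdiff_union_of_subset hC] at h3
  omega

/-- A `3`-connected minor is concentrated on one side of each `2`-separation. -/
lemma IsRankMinor.subsingleton_or_subsingleton (h : M.IsRankMinor N f I) (hN : N.NConnected 3)
    {A B : Set α} (hAB : A ∪ B = M.E) (hdj : Disjoint A B)
    (hr : M.finRk A + M.finRk B ≤ M.finRk M.E + 1) :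
    (N.E ∩ f ⁻¹' A).Subsingleton ∨ (N.E ∩ f ⁻¹' B).Subsingleton := by
  by_contra! hcon
  set ZA := N.E ∩ f ⁻¹' A
  set ZB := N.E ∩ f ⁻¹' B
  have hZ : N.E \ ZA = ZB := by
    ext x
    have hx : x ∈ N.E → f x ∈ A ∪ B := fun hx ↦ hAB ▸ h.image_subset (mem_image_of_mem f hx)
    have := fun h : f x ∈ A ↦ disjoint_left.1 hdj h
    simp only [ZA, ZB, mem_sdiff, mem_inter_iff, mem_preimage, mem_union] at *
    tauto
  have hZA : ZA ⊆ N.E := inter_subset_left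
  have hZB : ZB ⊆ N.E := inter_subset_left
  have h3 := hN.add_le_finRk_add_finRk hZA hZ.subset hcon.1 (hZ ▸ hcon.2)
  have hA := h.finRk_eq ZA hZA
  have hB := h.finRk_eq ZB hZB
  have hE := h.finRk_eq N.E subset_rfl
  have hfE : f '' N.E ⊆ f '' ZA ∪ f '' ZB := by
    rw [← image_union, ← hZ, union_sdiff_cancel hZA]
  have hfA : f '' ZA ⊆ A := by rintro _ ⟨x, hx, rfl⟩; exact hx.2
  have hfB : f '' ZB ⊆ B := by rintro _ ⟨x, hx, rfl⟩; exact hx.2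
  have hI := h.subset_ground
  rw [← hAB] at hI hr
  -- Connectivity does not grow in minors: `h1`, `h2`, `h4` account for contracting `I`, and `h5`,
  -- `h6` for restricting to the image of `N.E`.
  have h1 := M.finRk_submod (A := A) (B := I) (U := A ∪ I) (I := A ∩ I) subset_rfl
    inter_subset_left inter_subset_right
  have h2 := M.finRk_submod (A := B) (B := I) (U := B ∪ I) (I := B ∩ I) subset_rfl
    inter_subset_left inter_subset_right
  have h4 := M.finRk_submod (A := A ∩ I) (B := B ∩ I) (U := I) (I := ∅)
    (by rw [← union_inter_distrib_right]; exact subset_inter hI subset_rfl) (by simp) (by simp)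
  have h5 := M.finRk_submod (A := A ∪ I) (B := f '' N.E ∪ I) (U := A ∪ I ∪ f '' ZB)
    (I := f '' ZA ∪ I)
    (union_subset subset_union_left ((image_mono hZB).trans
      (subset_union_left.trans subset_union_right)))
    (union_subset_union_left _ hfA) (union_subset_union_left _ (image_mono hZA))
  have h6 := M.finRk_submod (A := B ∪ I) (B := A ∪ I ∪ f '' ZB) (U := A ∪ B)
    (I := f '' ZB ∪ I) (by intro x; simp; tauto)
    (union_subset_union_left _ hfB) (by intro x; simp; tauto)
  rw [finRk_empty] at h4
  omega

end minors

/-! ### Rerouting a minor through a 2-separation. -/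

section twoSum

variable {M : Matroid α} [M.Finite] {N : Matroid β} [N.Finite] {f : β → α} {I A B U J Z : Set α}

/-- If `U` is skew to `A`, then contracting `U` does not change the ranks of subsets of `A`. -/
lemma finRk_union_of_skew (hU : M.finRk (A ∪ U) = M.finRk A + M.finRk U) (hZ : Z ⊆ A) :
    M.finRk (Z ∪ U) = M.finRk Z + M.finRk U := by
  have h1 := M.finRk_submod (A := A) (B := Z ∪ U) (U := A ∪ U) (I := Z) (by intro x; simp; tauto)
    hZ subset_union_left
  have h2 := M.finRk_union_le Z U
  omega

/-- If `U` is as close to `A` as `B` is, then contracting `U` or `B` has the same effect on the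
ranks of subsets of `A`. -/
lemma finRk_union_of_not_skew (hUB : U ⊆ B)
    (hAB : M.finRk A + M.finRk B ≤ M.finRk (A ∪ B) + 1)
    (hU : M.finRk (A ∪ U) ≠ M.finRk A + M.finRk U) (hZ : Z ⊆ A) :
    M.finRk (Z ∪ U) + M.finRk B = M.finRk (Z ∪ B) + M.finRk U := by
  -- The local connectivity of `A` and `U` is at least one and that of `A` and `B` at most one, so
  -- `U` already carries everything that `B` does to `A`.
  have h0 := M.finRk_union_le A U
  have h1 := M.finRk_submod (A := A ∪ U) (B := Z ∪ B) (U := A ∪ B) (I := Z ∪ U)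
    (by intro x; simp; tauto) (union_subset_union_left _ hZ) (union_subset_union_right _ hUB)
  have h2 := M.finRk_submod (A := Z ∪ U) (B := B) (U := Z ∪ B) (I := U)
    (by intro x; simp; tauto) subset_union_right hUB
  have h3 := M.finRk_submod (A := A ∪ U) (B := B) (U := A ∪ B) (I := U)
    (by intro x; simp; tauto) subset_union_right hUB
  omega

/-- Given a `2`-separation `(A, B)` and a minor that uses at most one element of `B`, any
subset `J` of `B` skew to `A` can be contracted, keeping an isomorphic minor. -/
lemma IsRankMinor.exists_contract (h : M.IsRankMinor N f I) (hAB : A ∪ B = M.E)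
    (hdj : Disjoint A B) (hr : M.finRk A + M.finRk B = M.finRk M.E + 1) (hJB : J ⊆ B)
    (hJ : M.finRk (A ∪ J) = M.finRk A + M.finRk J) (hsub : (N.E ∩ f ⁻¹' B).Subsingleton)
    (hN1 : ∀ e ∈ N.E, N.finRk {e} = 1) (hN2 : ∀ e ∈ N.E, N.finRk (N.E \ {e}) = N.finRk N.E) :
    ∃ f' I', M.IsRankMinor N f' I' ∧ J ⊆ I' ∧ (N.E ∩ f' ⁻¹' B).Subsingleton := by
  classical
  have hI : I = (I ∩ A) ∪ (I ∩ B) := by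
    rw [← inter_union_distrib_left, hAB, inter_eq_self_of_subset_left h.subset_ground]
  rw [← hAB] at hr
  have hBE : B ⊆ M.E := hAB ▸ subset_union_right
  have hAE : A ⊆ M.E := hAB ▸ subset_union_left
  have hIAA : I ∩ A ⊆ A := inter_subset_right
  have hIBB : I ∩ B ⊆ B := inter_subset_right
  set IA := I ∩ A with hIA
  set IB := I ∩ B with hIB
  -- the ranks in the contraction by `I`
  have hrk : ∀ Z ⊆ N.E, M.finRk ((f '' Z ∪ IA) ∪ IB) = N.finRk Z + M.finRk (IA ∪ IB) := by
    intro Z hZ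
    rw [union_assoc, ← hI]
    exact h.finRk_eq Z hZ
  have hfA : ∀ Z ⊆ N.E, Disjoint Z (f ⁻¹' B) → f '' Z ⊆ A := by
    rintro Z hZ hd _ ⟨x, hx, rfl⟩
    have : f x ∈ A ∪ B := hAB ▸ h.image_subset (mem_image_of_mem f (hZ hx))
    exact this.resolve_right fun hB ↦ disjoint_left.1 hd hx hB
  obtain hemp | ⟨e₀, he₀⟩ := (N.E ∩ f ⁻¹' B).eq_empty_or_nonempty
  · have hNA : f '' N.E ⊆ A := hfA _ subset_rfl (disjoint_iff_inter_eq_empty.2 hemp)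
    -- A skew `IB` is invisible from `A` and may be swapped for `J`; a non-skew one acts on `A` as
    -- all of `B` does, and `B` contains `J`.
    by_cases hs : M.finRk (A ∪ IB) = M.finRk A + M.finRk IB
    · refine ⟨f, IA ∪ J, ⟨h.image_subset, union_subset (hIAA.trans hAE) (hJB.trans hBE), ?_⟩,
        subset_union_right, hsub⟩
      intro Z hZ
      have hZA : f '' Z ∪ IA ⊆ A := union_subset ((image_mono hZ).trans hNA) hIAA
      have h1 := hrk Z hZ
      rw [finRk_union_of_skew hs hZA, finRk_union_of_skew hs hIAA] at h1
      rw [← union_assoc, finRk_union_of_skew hJ hZA, finRk_union_of_skew hJ hIAA]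
      omega
    · refine ⟨f, IA ∪ B, ⟨h.image_subset, union_subset (hIAA.trans hAE) hBE, ?_⟩,
        hJB.trans subset_union_right, hsub⟩
      intro Z hZ
      have hZA : f '' Z ∪ IA ⊆ A := union_subset ((image_mono hZ).trans hNA) hIAA
      have h1 := hrk Z hZ
      have h2 := finRk_union_of_not_skew hIBB hr.le hs hZA
      have h3 := finRk_union_of_not_skew hIBB hr.le hs hIAA
      rw [← union_assoc]
      omega
  have he₀E := he₀.1
  have hne : ∀ Z ⊆ N.E, e₀ ∉ Z → f '' Z ⊆ A := fun Z hZ hd ↦ hfA Z hZ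
    (disjoint_left.2 fun x hx hxB ↦ hd (hsub he₀ ⟨hZ hx, hxB⟩ ▸ hx))
  set p := f e₀ with hp
  have hpB : p ∈ B := he₀.2
  have hpIB : insert p IB ⊆ B := insert_subset hpB hIBB
  -- ranks of `p` and of the complement of `p`
  have hp1 : M.finRk (IA ∪ insert p IB) = 1 + M.finRk (IA ∪ IB) := by
    have := hrk {e₀} (by simpa)
    rw [hN1 e₀ he₀E, image_singleton] at this
    rw [← this]
    congr 1; ext x; simp [hp, or_assoc]
  set Q := f '' (N.E \ {e₀}) with hQ
  have hQA : Q ⊆ A := hne _ sdiff_subset (by simp)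
  have hQI : Q ∪ IA ⊆ A := union_subset hQA hIAA
  have hp2 : M.finRk ((Q ∪ IA) ∪ insert p IB) = M.finRk ((Q ∪ IA) ∪ IB) := by
    rw [hrk _ sdiff_subset, hN2 e₀ he₀E, ← hrk _ subset_rfl]
    congr 1
    have : f '' N.E = insert p Q := by
      rw [hQ, hp, ← image_insert_eq, insert_sdiff_singleton, insert_eq_of_mem he₀E]
    rw [this]
    ext x; simp [or_assoc]
  have hi1 := M.finRk_insert_le p IB
  -- If adding `p` to `IB` did not change its effect on `A`, then `e₀` would be a loop or a coloop
  -- of `N`. So `IB` is skew to `A` and `insert p IB` is not.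
  have hs : M.finRk (A ∪ IB) = M.finRk A + M.finRk IB := by
    by_contra hs
    have hs' : M.finRk (A ∪ insert p IB) ≠ M.finRk A + M.finRk (insert p IB) := by
      have h0 := M.finRk_union_le A IB
      have h1 := M.finRk_submod (A := A ∪ IB) (B := insert p IB) (U := A ∪ insert p IB) (I := IB)
        (by intro x; simp) subset_union_right (subset_insert _ _)
      omega
    have h1 := finRk_union_of_not_skew hIBB hr.le hs hQI
    have h2 := finRk_union_of_not_skew hIBB hr.le hs hIAA
    have h3 := finRk_union_of_not_skew hpIB hr.le hs' hQI
    have h4 := finRk_union_of_not_skew hpIB hr.le hs' hIAA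
    omega
  have hs' : M.finRk (A ∪ insert p IB) ≠ M.finRk A + M.finRk (insert p IB) := by
    intro hs'
    have h1 := finRk_union_of_skew hs hQI
    have h2 := finRk_union_of_skew hs hIAA
    have h3 := finRk_union_of_skew hs' hQI
    have h4 := finRk_union_of_skew hs' hIAA
    omega
  have hpr : M.finRk (insert p IB) = M.finRk IB + 1 := by
    have h2 := finRk_union_of_skew hs hIAA
    have h0 := M.finRk_submod (A := IA ∪ IB) (B := insert p IB) (U := IA ∪ insert p IB) (I := IB)
        (by intro x; simp) subset_union_right (subset_insert _ _)
    omega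
  -- a maximal subset of `B` skew to `A`
  obtain ⟨U, hJU, hU⟩ := Set.Finite.exists_le_maximal
    (s := {U | U ⊆ B ∧ M.finRk (A ∪ U) = M.finRk A + M.finRk U})
    ((M.ground_finite.subset hBE).finite_subsets.subset fun U hU ↦ hU.1) ⟨hJB, hJ⟩
  obtain ⟨⟨hUB, hUs⟩, hUmax⟩ := hU
  -- By `hr` the whole of `B` is not skew to `A`. By maximality `q` stands to `U` as `p` stands to
  -- `IB`, so `q` can take over the role of `p` in the minor.
  obtain ⟨q, hqB, hqU⟩ : ∃ q ∈ B, q ∉ U := by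
    by_contra! hcon
    rw [hUB.antisymm hcon] at hUs
    omega
  have hqUB : insert q U ⊆ B := insert_subset hqB hUB
  have hqs : M.finRk (A ∪ insert q U) ≠ M.finRk A + M.finRk (insert q U) := fun hq ↦
    hqU (hUmax ⟨hqUB, hq⟩ (subset_insert q U) (mem_insert q U))
  have hqr : M.finRk (insert q U) = M.finRk U + 1 := by
    have h1 := M.finRk_submod (A := A ∪ U) (B := insert q U) (U := A ∪ insert q U) (I := U)
        (by intro x; simp) subset_union_right (subset_insert _ _)
    have := M.finRk_insert_le q U
    have := M.finRk_mono (subset_insert q U)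
    have := M.finRk_union_le A (insert q U)
    have := M.finRk_mono (union_subset_union_right A (subset_insert q U))
    omega
  have hf' : ∀ Z, e₀ ∉ Z → Function.update f e₀ q '' Z = f '' Z := fun Z hZ ↦
    image_congr fun x hx ↦ Function.update_of_ne (ne_of_mem_of_not_mem hx hZ) _ _
  have hf'' : ∀ Z, e₀ ∈ Z → Function.update f e₀ q '' Z = insert q (f '' (Z \ {e₀})) := by
    intro Z hZ
    rw [← hf' (Z \ {e₀}) (by simp)]
    nth_rewrite 1 [← insert_sdiff_self_of_mem hZ]
    rw [image_insert_eq, Function.update_self]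
  refine ⟨Function.update f e₀ q, IA ∪ U,
    ⟨?_, union_subset (hIAA.trans hAE) (hUB.trans hBE), ?_⟩, hJU.trans subset_union_right, ?_⟩
  · rw [hf'' _ he₀E]
    exact insert_subset (hBE hqB) (hQA.trans hAE)
  · intro Z hZ
    have hI1 := finRk_union_of_skew hs hIAA
    have hI2 := finRk_union_of_skew hUs hIAA
    have h1 := hrk Z hZ
    by_cases he₀Z : e₀ ∈ Z
    · have hWA : f '' (Z \ {e₀}) ∪ IA ⊆ A :=
        union_subset (hne _ (sdiff_subset.trans hZ) (by simp)) hIAA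
      have hZ1 : f '' Z ∪ IA ∪ IB = (f '' (Z \ {e₀}) ∪ IA) ∪ insert p IB := by
        nth_rewrite 1 [← insert_sdiff_self_of_mem he₀Z]
        rw [image_insert_eq]
        generalize f '' (Z \ {e₀}) = W
        ext x; simp; tauto
      have hZ2 : insert q (f '' (Z \ {e₀})) ∪ (IA ∪ U) =
          (f '' (Z \ {e₀}) ∪ IA) ∪ insert q U := by
        generalize f '' (Z \ {e₀}) = W
        ext x; simp; tauto
      rw [hZ1] at h1
      rw [hf'' Z he₀Z, hZ2]
      have h2 := finRk_union_of_not_skew hpIB hr.le hs' hWA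
      have h3 := finRk_union_of_not_skew hqUB hr.le hqs hWA
      omega
    · have hWA : f '' Z ∪ IA ⊆ A := union_subset (hne _ hZ he₀Z) hIAA
      rw [hf' Z he₀Z, ← union_assoc]
      have h2 := finRk_union_of_skew hs hWA
      have h3 := finRk_union_of_skew hUs hWA
      omega
  · have : ∀ x ∈ N.E ∩ Function.update f e₀ q ⁻¹' B, x = e₀ := by
      intro x hx
      by_contra hxe
      refine disjoint_left.1 hdj (hQA (mem_image_of_mem f (show x ∈ N.E \ {e₀} from ⟨hx.1, hxe⟩))) ?_
      simpa [Function.update_of_ne hxe] using hx.2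
    exact fun x hx y hy ↦ (this x hx).trans (this y hy).symm

end twoSum

/-- A vertical `3`-partition `(X, z, Y)`: both `(X ∪ z, Y)` and `(X, Y ∪ z)` are exact
`3`-separations with sides of rank at least three, and `z` is spanned by both `X` and `Y`. -/
structure IsVerticalPartition (M : Matroid α) (X : Set α) (z : α) (Y : Set α) : Prop where
  union_eq : X ∪ Y = M.E \ {z}
  disjoint : Disjoint X Y
  mem_ground : z ∈ M.E
  left_span : M.finRk (insert z X) = M.finRk X
  right_span : M.finRk (insert z Y) = M.finRk Y
  left_rank : 3 ≤ M.finRk X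
  right_rank : 3 ≤ M.finRk Y
  rank_add : M.finRk X + M.finRk Y = M.finRk M.E + 2

/-! ### Simplification, and the origin of vertical 3-partitions. -/

section simplification

variable {M : Matroid α} {e f : α}

lemma isNonloop_of_closure_eq (he : M.IsNonloop e) (h : M.closure {f} = M.closure {e}) :
    M.IsNonloop f := by
  have hmem : e ∈ M.closure {f} := h ▸ M.mem_closure_of_mem rfl (by simpa using he.mem_ground)
  have hE : f ∈ M.E := by
    by_contra hE
    rw [← M.closure_inter_ground, singleton_inter_eq_empty.2 hE] at hmem
    exact he.not_isLoop hmem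
  rw [← M.not_isLoop_iff hE]
  intro hl
  rw [hl.closure] at hmem
  exact he.not_isLoop hmem

lemma parallelRep_mem_si (he : M.IsNonloop e) : M.parallelRep e ∈ M.si.E :=
  ⟨isNonloop_of_closure_eq he (M.closure_parallelRep e),
    parallelRep_congr (M.closure_parallelRep e)⟩

lemma closure_image_parallelRep (M : Matroid α) (X : Set α) :
    M.closure (M.parallelRep '' X) = M.closure X := by
  rw [← biUnion_of_singleton X, image_iUnion₂]
  simp_rw [image_singleton]
  exact M.closure_biUnion_congr _ _ _ fun e _ ↦ M.closure_parallelRep e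

lemma finRk_congr {X Y : Set α} (h : M.closure X = M.closure Y) : M.finRk X = M.finRk Y := by
  rw [← finRk_closure, h, finRk_closure]

lemma finRk_si (M : Matroid α) {X : Set α} (hX : X ⊆ M.si.E) : M.si.finRk X = M.finRk X := by
  have : M.si.E = {e | M.IsNonloop e ∧ M.parallelRep e = e} := rfl
  rw [si, finRk_restrict, ← this, inter_eq_self_of_subset_left hX]

lemma si_subset_ground (M : Matroid α) : M.si.E ⊆ M.E := fun _ h ↦ h.1.mem_ground

lemma isNonloop_iff_finRk [M.RankFinite] : M.IsNonloop e ↔ M.finRk {e} = 1 := by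
  rw [← eRk_singleton_eq_one_iff, ← cast_finRk]
  norm_cast

instance si_finite [M.Finite] : M.si.Finite :=
  ⟨M.ground_finite.subset M.si_subset_ground⟩

/-- Passing to representatives preserves closures, hence ranks. Loops in `I` are dropped because
they have no representative in the simplification. -/
lemma IsRankMinor.si [M.Finite] {N : Matroid β} [N.Finite] {f : β → α} {I : Set α}
    (h : M.IsRankMinor N f I) (hN1 : ∀ e ∈ N.E, N.finRk {e} = 1) :
    M.si.IsRankMinor N (M.parallelRep ∘ f) (M.parallelRep '' (I \ M.loops)) := by
  have hf : ∀ e ∈ N.E, M.IsNonloop (f e) := by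
    intro e he
    have h1 := h.finRk_eq {e} (by simpa)
    rw [image_singleton, hN1 e he] at h1
    have h2 := M.finRk_union_le {f e} I
    have h3 := M.finRk_singleton_le (f e)
    rw [isNonloop_iff_finRk]
    omega
  have hss : (M.parallelRep ∘ f) '' N.E ⊆ M.si.E := by
    rintro _ ⟨e, he, rfl⟩
    exact parallelRep_mem_si (hf e he)
  have hIss : M.parallelRep '' (I \ M.loops) ⊆ M.si.E := by
    rintro _ ⟨e, he, rfl⟩
    exact parallelRep_mem_si ((M.not_isLoop_iff (h.subset_ground he.1)).1 he.2)
  have hcl : ∀ Z, M.closure (M.parallelRep '' (f '' Z) ∪ M.parallelRep '' (I \ M.loops)) =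
      M.closure (f '' Z ∪ I) := by
    intro Z
    rw [← image_union, closure_image_parallelRep, ← M.closure_union_closure_right_eq,
      closure_sdiff_loops_eq, closure_union_closure_right_eq]
  refine ⟨hss, hIss, fun Z hZ ↦ ?_⟩
  have h2 := hcl ∅
  rw [image_empty, image_empty, empty_union, empty_union] at h2
  rw [finRk_si _ (union_subset ((image_mono hZ).trans hss) hIss), finRk_si _ hIss, image_comp,
    finRk_congr (hcl Z), finRk_congr h2, h.finRk_eq Z hZ]

/-- If `si(M / z)` is not `3`-connected, then `z` is the guts of a vertical `3`-partition. -/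
lemma NConnected.exists_isVerticalPartition [M.Finite] (hM : M.NConnected 3)
    (h4 : 4 ≤ M.E.encard) {z : α} (hz : z ∈ M.E) (hsi : ¬ (M ／ {z}).si.NConnected 3) :
    ∃ X Y, M.IsVerticalPartition X z Y := by
  have hz1 := hM.finRk_singleton h4 hz
  have hcon : ∀ X, (M ／ {z}).finRk X + 1 = M.finRk (insert z X) := fun X ↦ by
    rw [← hz1, finRk_contract, union_singleton]
  have hnl : ∀ e ∈ M.E \ {z}, (M ／ {z}).IsNonloop e := by
    rintro e ⟨he, hez⟩
    have := hcon {e}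
    rw [hM.finRk_pair h4 hz he (Ne.symm hez)] at this
    rw [isNonloop_iff_finRk]
    omega
  simp only [NConnected, not_forall, not_not] at hsi
  obtain ⟨k, hk, A, B, hAB⟩ := hsi
  set p := (M ／ {z}).parallelRep with hp
  have hrep : ∀ e ∈ M.E \ {z}, p e ∈ A ∪ B := fun e he ↦
    hAB.union_eq ▸ parallelRep_mem_si (hnl e he)
  have hss : ∀ S ⊆ (M ／ {z}).si.E, (M ／ {z}).si.finRk S = (M ／ {z}).finRk (M.E \ {z} ∩ p ⁻¹' S) ∧
      S ⊆ M.E \ {z} ∩ p ⁻¹' S := by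
    intro S hS
    have hSs : S ⊆ M.E \ {z} ∩ p ⁻¹' S := fun x hx ↦ ⟨si_subset_ground _ (hS hx), by
      have : p x = x := (hS hx).2
      simpa [this]⟩
    refine ⟨?_, hSs⟩
    rw [finRk_si _ hS]
    apply le_antisymm (finRk_mono _ hSs)
    rw [← finRk_congr (closure_image_parallelRep _ (M.E \ {z} ∩ p ⁻¹' S))]
    apply finRk_mono
    rintro _ ⟨x, hx, rfl⟩
    exact hx.2
  have hAE : A ⊆ (M ／ {z}).si.E := hAB.union_eq ▸ subset_union_left
  have hBE : B ⊆ (M ／ {z}).si.E := hAB.union_eq ▸ subset_union_right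
  obtain ⟨hA, hAX⟩ := hss A hAE
  obtain ⟨hB, hBY⟩ := hss B hBE
  have hE := (hss _ subset_rfl).1
  -- Fatten both sides to unions of parallel classes of `M ／ {z}`; this leaves ranks unchanged.
  set X := M.E \ {z} ∩ p ⁻¹' A with hX
  set Y := M.E \ {z} ∩ p ⁻¹' B with hY
  have hXY : X ∪ Y = M.E \ {z} := by
    rw [hX, hY, ← inter_union_distrib_left, ← preimage_union]
    exact inter_eq_left.2 hrep
  have hdj : Disjoint X Y := disjoint_left.2 fun e he he' ↦
    disjoint_left.1 hAB.disjoint he.2 he'.2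
  have hE' : M.E \ {z} ∩ p ⁻¹' (M ／ {z}).si.E = M.E \ {z} := by
    rw [← hAB.union_eq]; exact inter_eq_left.2 hrep
  have hconn := hAB.conn_lt
  have hBA : (M ／ {z}).si.E \ A = B := by
    rw [← hAB.union_eq, union_sdiff_left, hAB.disjoint.symm.sdiff_eq_left]
  rw [conn, hBA, hA, hB, hE, hE'] at hconn
  have hcX := hcon X
  have hcY := hcon Y
  have hcE := hcon (M.E \ {z})
  rw [insert_sdiff_singleton, insert_eq_of_mem hz] at hcE
  have hXE : X ⊆ M.E := inter_subset_left.trans sdiff_subset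
  have hYE : Y ⊆ M.E := inter_subset_left.trans sdiff_subset
  have hzX : z ∉ X := fun h ↦ h.1.2 rfl
  have hzY : z ∉ Y := fun h ↦ h.1.2 rfl
  have hsum : (M.finRk (insert z X) + M.finRk (insert z Y) : ℤ) < M.finRk M.E + k + 1 := by omega
  -- ranks of the two sides
  have hYX : M.E \ X = insert z Y := by
    ext x
    have : x ∈ X ∪ Y ↔ x ∈ M.E \ {z} := by rw [hXY]
    have : x ∈ X → x ∉ Y := fun h ↦ disjoint_left.1 hdj h
    simp only [mem_union, mem_sdiff, mem_singleton_iff, mem_insert_iff] at *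
    by_cases x = z
    · simp_all
    · tauto
  have hXY' : M.E \ Y = insert z X := by
    ext x
    have : x ∈ X ∪ Y ↔ x ∈ M.E \ {z} := by rw [hXY]
    have : x ∈ X → x ∉ Y := fun h ↦ disjoint_left.1 hdj h
    simp only [mem_union, mem_sdiff, mem_singleton_iff, mem_insert_iff] at *
    by_cases x = z
    · simp_all
    · tauto
  have hk0 : 1 ≤ k := by
    have h1 := M.finRk_submod (A := insert z X) (B := insert z Y) (U := M.E) (I := {z})
      (by
        rw [insert_union, union_insert, hXY]
        intro x hx
        by_cases x = z <;> simp_all) (by simp) (by simp)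
    omega
  have hXn : X.Nonempty := by
    refine Nonempty.mono hAX (one_le_encard_iff_nonempty.1 (le_trans ?_ hAB.left_card))
    exact_mod_cast hk0
  have hYn : Y.Nonempty := by
    refine Nonempty.mono hBY (one_le_encard_iff_nonempty.1 (le_trans ?_ hAB.right_card))
    exact_mod_cast hk0
  -- A singleton `S` yields `insert z S` of rank two, and then the bound fails only without slack.
  -- The extra one, needed when `k = 2`, is therefore granted only from rank three on.
  have key : ∀ S T, S ⊆ M.E → z ∉ S → M.E \ S = insert z T → z ∉ T → S.Nonempty → T.Nonempty →
      M.finRk (insert z S) + M.finRk (insert z T) ≤ M.finRk M.E + 1 +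
      (if M.finRk (insert z S) ≤ 2 then 0 else 1) →
      M.finRk M.E + 2 ≤ M.finRk S + M.finRk (insert z T) := by
    intro S T hSE hzS hST hzT hS hT hsum
    obtain ⟨s, hs⟩ := hS
    obtain ⟨t, ht⟩ := hT
    obtain hS1 | hS1 := S.subsingleton_or_nontrivial
    · obtain rfl := hS1.eq_singleton_of_mem hs
      rw [← hST, hM.finRk_compl_singleton h4 (hSE rfl), hM.finRk_pair h4 hz (hSE rfl) (by
        rintro rfl; exact hzS rfl)] at hsum
      simp at hsum
      omega
    · refine hM.add_le_finRk_add_finRk hSE hST.subset hS1 ?_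
      rw [hST]
      exact ⟨z, mem_insert _ _, t, mem_insert_of_mem _ ht, by rintro rfl; exact hzT ht⟩
  have hmX := M.finRk_mono (subset_insert z X)
  have hmY := M.finRk_mono (subset_insert z Y)
  have hk2 : k = 2 := by
    by_contra hk2
    have := key X Y hXE hzX hYX hzY hXn hYn (by split_ifs <;> omega)
    omega
  subst hk2
  -- Two distinct elements of the simplification are not parallel in `M ／ {z}`, so they have rank
  -- three together with `z`.
  have hrank : ∀ S ⊆ (M ／ {z}).si.E, (2 : ℕ) ≤ S.encard → 3 ≤ M.finRk (insert z S) := by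
    intro S hS hS2
    obtain ⟨a, ha, b, hb, hab⟩ := two_le_encard_iff_nontrivial.1 hS2
    rw [← hcon]
    have h1 := finRk_mono (M ／ {z}) (pair_subset ha hb)
    by_contra hcon'
    have hle : (M ／ {z}).finRk {a, b} ≤ 1 := by omega
    have hna := hnl a (si_subset_ground _ (hS ha))
    have hnb := hnl b (si_subset_ground _ (hS hb))
    have ha1 := isNonloop_iff_finRk.1 hna
    have hb1 := isNonloop_iff_finRk.1 hnb
    have hma := finRk_mono (M ／ {z}) (singleton_subset_iff.2 (mem_insert a {b}))
    have hca : b ∈ (M ／ {z}).closure {a} := by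
      rw [mem_closure_iff_finRk hnb.mem_ground, pair_comm]; omega
    have hpa : p a = a := (hS ha).2
    have hpb : p b = b := (hS hb).2
    apply hab
    rw [← hpa, ← hpb]
    exact parallelRep_congr (hnb.closure_eq_of_mem_closure hca).symm
  have hX3 := (hrank A hAE hAB.left_card).trans (M.finRk_mono (insert_subset_insert hAX))
  have hY3 := (hrank B hBE hAB.right_card).trans (M.finRk_mono (insert_subset_insert hBY))
  have hX4 := key X Y hXE hzX hYX hzY hXn hYn (by split_ifs <;> omega)
  have hY4 := key Y X hYE hzY hXY' hzX hYn hXn (by split_ifs <;> omega)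
  exact ⟨X, Y, hXY, hdj, hz, by omega, by omega, by omega, by omega, by omega⟩

end simplification

/-! ### Vertical 3-partitions, long lines and lobes. -/

section vertical

variable {M : Matroid α} [M.Finite] {X Y A S T L : Set α} {x y z t e : α}

lemma nontrivial_of_two_le_finRk (h : 2 ≤ M.finRk X) : X.Nontrivial := by
  rw [← two_le_encard_iff_nontrivial]
  exact le_trans (by exact_mod_cast h) (M.finRk_le_encard X)

namespace IsVerticalPartition

lemma symm (h : M.IsVerticalPartition X z Y) : M.IsVerticalPartition Y z X :=
  ⟨by rw [union_comm, h.union_eq], h.disjoint.symm, h.mem_ground, h.right_span, h.left_span,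
    h.right_rank, h.left_rank, by rw [add_comm, h.rank_add]⟩

lemma right_eq (h : M.IsVerticalPartition X z Y) : Y = M.E \ insert z X := by
  have h1 := h.union_eq
  have h2 := h.disjoint
  have : Y = (X ∪ Y) \ X := by rw [union_sdiff_left, h2.symm.sdiff_eq_left]
  rw [this, h1]
  grind

lemma left_subset (h : M.IsVerticalPartition X z Y) : X ⊆ M.E :=
  (h.union_eq ▸ subset_union_left (s := X)).trans sdiff_subset

lemma left_eq (h : M.IsVerticalPartition X z Y) : X = M.E \ insert z Y := h.symm.right_eq

lemma right_subset (h : M.IsVerticalPartition X z Y) : Y ⊆ M.E := h.symm.left_subset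

lemma notMem_left (h : M.IsVerticalPartition X z Y) : z ∉ X := by
  have := h.left_eq
  grind

lemma notMem_right (h : M.IsVerticalPartition X z Y) : z ∉ Y := h.symm.notMem_left

lemma mem_or (h : M.IsVerticalPartition X z Y) (he : e ∈ M.E) : e ∈ X ∨ e = z ∨ e ∈ Y := by
  have := h.right_eq
  grind

/-- An upper bound on the connectivity suffices: 3-connectivity supplies the reverse inequality and
forces `z` into the closure of `Y` too. Uncrossing produces its new partitions this way. -/
lemma of_le (hM : M.NConnected 3) (hz : z ∈ M.E) (hY : Y = M.E \ insert z X)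
    (hX : X ⊆ M.E) (hzX : z ∉ X) (hs : M.finRk (insert z X) = M.finRk X) (hX3 : 3 ≤ M.finRk X)
    (hY3 : 3 ≤ M.finRk (insert z Y)) (hr : M.finRk X + M.finRk (insert z Y) ≤ M.finRk M.E + 2) :
    M.IsVerticalPartition X z Y := by
  have hYX : M.E \ Y = insert z X := by grind
  have h1 := M.finRk_insert_le z Y
  have h2 := hM.add_le_finRk_add_finRk (A := Y) (B := insert z X) (by grind) hYX.subset
    (nontrivial_of_two_le_finRk (M := M) (by omega))
    (hYX ▸ nontrivial_of_two_le_finRk (M := M) (by omega))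
  have h3 := M.finRk_mono (subset_insert z Y)
  exact ⟨by grind, by rw [disjoint_left]; grind, hz, hs, by omega, hX3, by omega, by omega⟩

/-- Elements spanned by one side of a vertical `3`-partition can be moved to that side. -/
lemma union_left (h : M.IsVerticalPartition X z Y) (hM : M.NConnected 3) (h4 : 4 ≤ M.E.encard)
    (hA : A ⊆ M.E) (hz : z ∉ A) (hs : ∀ a ∈ A, M.finRk (insert a X) = M.finRk X) :
    M.IsVerticalPartition (X ∪ A) z (Y \ A) := by
  have hr := finRk_union_eq_of_forall M hs
  have hzr := M.finRk_insert_eq_of_subset (subset_union_left (s := X) (t := A)) h.left_span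
  have hX := h.left_subset
  have hY := h.right_eq
  have hzX := h.notMem_left
  have h1 := h.rank_add
  have h2 := h.right_rank
  have h3 := h.left_rank
  have h4' := h.right_span
  have hE : M.E \ insert z (X ∪ A) = Y \ A := by grind
  have h5 := hM.add_le_finRk_add_finRk (A := insert z (X ∪ A)) (B := Y \ A)
    (by have := h.mem_ground; grind) hE.subset
    (nontrivial_of_two_le_finRk (M := M) (by omega)) (hM.compl_nontrivial h4 (by omega))
  have h6 := M.finRk_mono (subset_insert z (Y \ A))
  have h7 := M.finRk_mono (show insert z (Y \ A) ⊆ insert z Y by grind)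
  exact of_le hM h.mem_ground hE.symm (by grind) (by grind) hzr (by omega) (by omega) (by omega)

end IsVerticalPartition

/-- A closed set of rank two with at least three elements. -/
structure IsLongLine (M : Matroid α) (L : Set α) : Prop where
  subset_ground : L ⊆ M.E
  finRk_eq : M.finRk L = 2
  mem_of_finRk : ∀ e ∈ M.E, M.finRk (insert e L) = 2 → e ∈ L
  card : 3 ≤ L.encard

/-- The element `t` completes `L - x` to a cocircuit. -/
structure IsLobe (M : Matroid α) (L : Set α) (x t : α) : Prop where
  notMem : t ∉ L
  isCocircuit : M.IsCocircuit (L \ {x} ∪ {t})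

lemma IsLongLine.exists_ne (hL : M.IsLongLine L) (a b : α) : ∃ c ∈ L, c ≠ a ∧ c ≠ b := by
  by_contra! hcon
  have h1 : L ⊆ {a, b} := by intro x hx; simp; have := hcon x hx; tauto
  have h2 := (encard_le_encard h1).trans ((encard_insert_le _ _).trans (by
    rw [encard_singleton, one_add_one_eq_two]))
  have := hL.card.trans h2
  norm_num at this

/-- A set spanning two elements of a line spans the line. -/
lemma finRk_union_line (hM : M.NConnected 3) (h4 : 4 ≤ M.E.encard) (hLE : L ⊆ M.E)
    (hL : M.finRk L ≤ 2) (hx : x ∈ L) (hy : y ∈ L) (hxy : x ≠ y)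
    (hxS : M.finRk (insert x S) = M.finRk S) (hyS : M.finRk (insert y S) = M.finRk S) :
    M.finRk (S ∪ L) = M.finRk S := by
  have h1 := M.finRk_insert_eq_of_subset (subset_insert y S) hxS
  have h2 := M.finRk_submod (A := insert x (insert y S)) (B := L) (U := S ∪ L) (I := {x, y})
    (by grind) (by grind) (by grind)
  have h3 := hM.finRk_pair h4 (hLE hx) (hLE hy) hxy
  have h5 := M.finRk_mono (subset_union_left (s := S) (t := L))
  omega

lemma finRk_insert_of_mem (h : x ∈ S) : M.finRk (insert x S) = M.finRk S := by
  rw [insert_eq_of_mem h]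

/-- A vertical `3`-partition one side of which consists of all but one element `y` of a set of
rank two, together with a further element, arises from a long line and a cocircuit. -/
lemma IsVerticalPartition.isLobe (h : M.IsVerticalPartition (L \ {y} ∪ {t}) y S)
    (hM : M.NConnected 3) (h4 : 4 ≤ M.E.encard) (hy : y ∈ L) (hLE : L ⊆ M.E) (hL : M.finRk L ≤ 2)
    (ht : t ∉ L) : M.IsLongLine L ∧ M.IsLobe L y t := by
  have hTE := h.left_subset
  have hS := h.right_eq
  have hr := h.rank_add
  have hT3 := h.left_rank
  have hS3 := h.right_rank
  have hyS := h.right_span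
  have htE : t ∈ M.E := hTE (by simp)
  have hcard : 3 ≤ L.encard := by
    have h1 := M.finRk_le_encard (L \ {y} ∪ {t})
    have h2 : (L \ {y} ∪ {t}).encard = L.encard := by
      rw [encard_union_eq (by simp [ht]), encard_singleton, encard_sdiff_singleton_add_one hy]
    rw [← h2]
    exact le_trans (by exact_mod_cast hT3) h1
  have h1 : M.finRk (L \ {y} ∪ {t}) ≤ M.finRk (L \ {y}) + 1 := by
    rw [union_singleton]; exact M.finRk_insert_le _ _
  have h2 := M.finRk_mono (sdiff_subset (s := L) (t := {y}))
  have hSr : M.finRk S + 1 = M.finRk M.E := by omega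
  have hSE : M.E \ (L \ {y} ∪ {t}) = insert y S := by grind
  have hco : M.IsCocircuit (L \ {y} ∪ {t}) := by
    rw [isCocircuit_iff_finRk hTE, hSE, hyS]
    refine ⟨hSr, fun d hd ↦ ?_⟩
    by_contra hcon
    have h3 := M.finRk_le_ground (insert d (insert y S))
    have h5 := M.finRk_mono (subset_insert d (insert y S))
    have h6 : M.finRk (insert d (insert y S)) = M.finRk S := by omega
    -- If the hyperplane spanned `t`, then `L \ {y}` would be one side of a 2-separation; if it
    -- spanned another point of `L`, it would span `L` and hence everything except `t`.
    by_cases hdt : d = t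
    · subst hdt
      have h7 := hM.add_le_finRk_add_finRk (A := L \ {y}) (B := insert d (insert y S)) (by grind)
        (by grind) (nontrivial_of_two_le_finRk (M := M) (by omega))
        (hM.compl_nontrivial h4 (by omega))
      omega
    · have h7 := finRk_union_line hM h4 hLE hL hy (show d ∈ L by grind) (show y ≠ d by grind) hyS
        (by have := M.finRk_mono (show insert d S ⊆ insert d (insert y S) by grind)
            have := M.finRk_mono (subset_insert d S)
            omega)
      have h8 := M.finRk_mono (show M.E \ {t} ⊆ S ∪ L by grind)
      rw [hM.finRk_compl_singleton h4 htE] at h8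
      omega
  refine ⟨⟨hLE, by omega, fun e he hre ↦ ?_, hcard⟩, ht, hco⟩
  by_contra heL
  obtain ⟨c, hc⟩ : (L \ {y}).Nonempty :=
    (nontrivial_of_two_le_finRk (M := M) (by omega)).nonempty
  obtain rfl | het := eq_or_ne e t
  · have := M.finRk_mono (show L \ {y} ∪ {e} ⊆ insert e L by grind)
    omega
  -- The cocircuit contains `c` and avoids `y` and `e`, so these three elements cannot be collinear.
  · have h7 := hco.finRk_insert (e := c) (X := {y, e}) (by grind) (by
      rw [disjoint_left]; grind)
    have h8 := M.finRk_mono (show insert c {y, e} ⊆ insert e L by grind)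
    have h9 := hM.finRk_pair h4 (hLE hy) he (by grind)
    omega

end vertical

/-! ### Crossing vertical partitions along a line: how lobes spread. -/

section lobes

variable {M : Matroid α} [M.Finite] {X Y A S T S' T' L : Set α} {x y z s t g h t' w e : α}

/-- A line that meets one side of a vertical partition in a point other than the guts can be
moved to that side. -/
lemma IsVerticalPartition.union_line (hv : M.IsVerticalPartition X x Y)
    (hM : M.NConnected 3) (h4 : 4 ≤ M.E.encard) (hL : M.IsLongLine L) (hx : x ∈ L) (he : e ∈ L)
    (heX : e ∈ X) : M.IsVerticalPartition (X ∪ L \ {x}) x (Y \ (L \ {x})) := by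
  refine hv.union_left hM h4 (A := L \ {x}) (sdiff_subset.trans hL.subset_ground) (by simp) ?_
  intro a ha
  have h1 := finRk_union_line hM h4 hL.subset_ground hL.finRk_eq.le hx he
    (by have := hv.notMem_left; grind) hv.left_span (finRk_insert_of_mem heX)
  have h2 := M.finRk_mono (show insert a X ⊆ X ∪ L by grind)
  have h3 := M.finRk_mono (subset_insert a X)
  omega

/-- If there is a vertical partition with guts `x` on the line `L`, then there is one with
`L - x` contained in one side. -/
lemma IsVerticalPartition.exists_line_subset (hv : M.IsVerticalPartition X x Y)
    (hM : M.NConnected 3) (h4 : 4 ≤ M.E.encard) (hL : M.IsLongLine L) (hx : x ∈ L) :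
    ∃ S T, M.IsVerticalPartition S x T ∧ L \ {x} ⊆ S := by
  obtain ⟨p, hpL, hpx, -⟩ := hL.exists_ne x x
  obtain hp | hp | hp := hv.mem_or (hL.subset_ground hpL)
  · exact ⟨_, _, hv.union_line hM h4 hL hx hpL hp, subset_union_right⟩
  · exact absurd hp hpx
  · exact ⟨_, _, hv.symm.union_line hM h4 hL hx hpL hp, subset_union_right⟩

lemma IsLobe.mem_ground (hg : M.IsLobe L g t) : t ∈ M.E :=
  hg.isCocircuit.subset_ground (by simp)

/-- The set `L - g ∪ t` meets every set spanning one of its elements. -/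
lemma IsLobe.finRk_insert (hg : M.IsLobe L g t) (hx : x ∈ L) (hxg : x ≠ g)
    (hX : X ∩ L ⊆ {g}) (ht : t ∉ X) : M.finRk (insert x X) = M.finRk X + 1 :=
  hg.isCocircuit.finRk_insert (by grind) (by rw [disjoint_left]; grind)

/-- The cocircuit of a lobe meets the far side of a vertical partition. -/
lemma IsLobe.mem_right (hg : M.IsLobe L g t) (hv : M.IsVerticalPartition X x Y) (hx : x ∈ L)
    (hxg : x ≠ g) (hLX : L \ {x} ⊆ X) : t ∈ Y := by
  by_contra ht
  have h1 := hg.finRk_insert (X := Y) hx hxg (by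
    have := hv.right_eq; grind) ht
  have h2 := hv.right_span
  omega

/-- Two lobes make a set that avoids them skew to the line. -/
lemma IsLobe.finRk_union (hg : M.IsLobe L g t) (hh : M.IsLobe L h t') (hgL : g ∈ L) (hhL : h ∈ L)
    (hgh : g ≠ h) (hAL : Disjoint A L) (ht : t ∉ A) (ht' : t' ∉ A) :
    M.finRk A + 2 ≤ M.finRk (A ∪ L) := by
  rw [disjoint_left] at hAL
  have h1 := hh.finRk_insert (X := A) hgL hgh (by grind) ht'
  have h2 := hg.finRk_insert (X := insert g A) hhL hgh.symm (by grind)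
    (by have := hg.notMem; grind)
  have h3 := M.finRk_mono (show insert h (insert g A) ⊆ A ∪ L by grind)
  omega

/-- If `L` has lobes at two elements other than `x`, a vertical partition at `x` having
`L - x` on one side has only one further element on that side. -/
lemma IsVerticalPartition.exists_eq (hv : M.IsVerticalPartition X x Y) (hM : M.NConnected 3)
    (h4 : 4 ≤ M.E.encard) (hL : M.IsLongLine L) (hx : x ∈ L) (hLX : L \ {x} ⊆ X)
    (hg : M.IsLobe L g t) (hh : M.IsLobe L h t') (hgL : g ∈ L) (hhL : h ∈ L)
    (hgh : g ≠ h) (hxg : x ≠ g) (hxh : x ≠ h) : ∃ b, b ∉ L ∧ X = L \ {x} ∪ {b} := by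
  have ht := hg.mem_right hv hx hxg hLX
  have ht' := hh.mem_right hv hx hxh hLX
  have hYE := hv.right_eq
  have hXE := hv.left_subset
  have hxX := hv.notMem_left
  have hr := hv.rank_add
  have hr3 := hv.left_rank
  have hL2 := hL.finRk_eq
  have hLE := hL.subset_ground
  have h1 := hg.finRk_union hh hgL hhL hgh (A := X \ L) disjoint_sdiff_left (by grind) (by grind)
  have h2 := M.finRk_mono (show X \ L ∪ L ⊆ insert x X by grind)
  have h3 := M.finRk_submod (A := insert x Y) (B := L) (U := Y ∪ L) (I := {x}) (by grind)
    (by grind) (by grind)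
  have h5 := hM.finRk_singleton h4 (hLE hx)
  have h6 := hv.left_span
  have h7 := hv.right_span
  have h8 := hv.right_rank
  obtain ⟨b, hb⟩ : (X \ L).Nonempty := by
    by_contra hcon
    rw [not_nonempty_iff_eq_empty, sdiff_eq_empty] at hcon
    have := M.finRk_mono hcon
    omega
  refine ⟨b, hb.2, ?_⟩
  obtain hs | hn := (X \ L).subsingleton_or_nontrivial
  · have := hs.eq_singleton_of_mem hb
    ext p
    have : p ∈ X \ L ↔ p ∈ ({b} : Set α) := by rw [this]
    grind
  -- Skewness makes r(X - L) at most r(X) - 2, while r(Y ∪ L) is at most r(Y) + 1; together they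
  -- would give a 2-separation.
  · have h9 := hM.add_le_finRk_add_finRk (A := X \ L) (B := Y ∪ L) (by grind) (by grind) hn
      (hM.compl_nontrivial h4 (by omega))
    omega

/-- The asymmetric core of the crossing argument for two vertical partitions along a line. -/
lemma IsLobe.lobes_of_subsingleton (hw : M.IsLobe L x w) (hM : M.NConnected 3)
    (h4 : 4 ≤ M.E.encard) (hL : M.IsLongLine L) (hx : x ∈ L) (hy : y ∈ L) (hs : s ∈ L)
    (hxy : x ≠ y) (hxs : x ≠ s) (hys : y ≠ s) (hv : M.IsVerticalPartition S y T)
    (hv' : M.IsVerticalPartition S' s T') (hLS' : L \ {s} ⊆ S')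
    (hS : S = L \ {y} ∪ (S ∩ T')) (hb : (S ∩ T').Subsingleton) :
    (∃ t, M.IsLobe L y t) ∧ ∃ t, M.IsLobe L s t := by
  have hL2 := hL.finRk_eq
  obtain ⟨t, ht⟩ : (S ∩ T').Nonempty := by
    by_contra hcon
    rw [not_nonempty_iff_eq_empty] at hcon
    rw [hcon, union_empty] at hS
    have h1 := hv.left_rank
    have h2 := M.finRk_mono (hS.subset.trans sdiff_subset)
    omega
  rw [hb.eq_singleton_of_mem ht] at hS
  have htL : t ∉ L := by have := hv'.right_eq; grind
  have hly : M.IsLobe L y t := ((hS ▸ hv).isLobe hM h4 hy hL.subset_ground hL2.le htL).2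
  refine ⟨⟨t, hly⟩, ?_⟩
  obtain ⟨b, hbL, hbS⟩ := hv'.exists_eq hM h4 hL hs hLS' hw hly hx hy hxy hxs.symm hys.symm
  exact ⟨b, ((hbS ▸ hv').isLobe hM h4 hs hL.subset_ground hL2.le hbL).2⟩

/-- Given a lobe at one element of a line, vertical partitions at two other elements give lobes
at these elements. -/
lemma IsLobe.lobes (hw : M.IsLobe L x w) (hM : M.NConnected 3)
    (h4 : 4 ≤ M.E.encard) (hL : M.IsLongLine L) (hx : x ∈ L) (hy : y ∈ L) (hs : s ∈ L)
    (hxy : x ≠ y) (hxs : x ≠ s) (hys : y ≠ s) (hv : M.IsVerticalPartition S y T)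
    (hv' : M.IsVerticalPartition S' s T') :
    (∃ t, M.IsLobe L y t) ∧ ∃ t, M.IsLobe L s t := by
  obtain ⟨S, T, hv, hLS⟩ := hv.exists_line_subset hM h4 hL hy
  obtain ⟨S', T', hv', hLS'⟩ := hv'.exists_line_subset hM h4 hL hs
  have hwT := hw.mem_right hv hy hxy.symm hLS
  have hwT' := hw.mem_right hv' hs hxs.symm hLS'
  have hT := hv.right_eq
  have hT' := hv'.right_eq
  have hSE := hv.left_subset
  have hSE' := hv'.left_subset
  have hyS := hv.notMem_left
  have hsS' := hv'.notMem_left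
  have hLE := hL.subset_ground
  have hwL := hw.notMem
  have hr := hv.rank_add
  have hr' := hv'.rank_add
  have hT3 := hv.right_rank
  have hT3' := hv'.right_rank
  have hl := hv.left_span
  have hl' := hv'.left_span
  have hri := hv.right_span
  have hri' := hv'.right_span
  -- not both `S ∩ S' - L` and `T ∩ T' - w` are nonempty
  have claim1 : (∀ p ∈ S, p ∈ S' → p ∈ L) ∨ (∀ q ∈ T, q ∈ T' → q = w) := by
    by_contra! hcon
    obtain ⟨⟨p, hpS, hpS', hpL⟩, q, hqT, hqT', hqw⟩ := hcon
    have h1 := M.finRk_submod (A := T) (B := T') (U := T ∪ T') (I := T ∩ T') subset_rfl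
      inter_subset_left inter_subset_right
    have h2 := M.finRk_submod (A := insert y S) (B := insert s S') (U := S ∪ S')
      (I := S ∩ S' ∪ L) (by grind) (by grind) (by grind)
    have h3 := hM.add_le_finRk_add_finRk (A := T ∩ T') (B := S ∪ S') (by grind) (by grind)
      ⟨w, ⟨hwT, hwT'⟩, q, ⟨hqT, hqT'⟩, hqw.symm⟩ ⟨p, by grind, x, by grind, by grind⟩
    have h5 := hw.finRk_insert (X := insert x ((S ∩ S') \ L)) hy hxy.symm (by grind) (by grind)
    have h6 := M.finRk_mono (show insert y (insert x ((S ∩ S') \ L)) ⊆ S ∩ S' ∪ L by grind)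
    have h7 := finRk_union_line hM h4 hLE hL.finRk_eq.le hy hs hys (S := T ∪ T')
      (M.finRk_insert_eq_of_subset subset_union_left hri)
      (M.finRk_insert_eq_of_subset subset_union_right hri')
    have h8 := hM.add_le_finRk_add_finRk (A := insert x ((S ∩ S') \ L)) (B := T ∪ T' ∪ L)
      (by grind) (by grind) ⟨x, by grind, p, by grind, by grind⟩ ⟨w, by grind, q, by grind, hqw.symm⟩
    omega
  -- As in `claim1`, two submodular inequalities bound a total by 2r(M) + 4. Two uses of
  -- 3-connectivity, and the extra one from the lobe cocircuit (`h5`), make it at least 2r(M) + 5.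
  have claim2 : (S ∩ T').Subsingleton ∨ (T ∩ S').Subsingleton := by
    by_contra! hcon
    obtain ⟨hb, hc⟩ := hcon
    have h1 := M.finRk_submod (A := S) (B := T') (U := S ∪ T') (I := S ∩ T') subset_rfl
      inter_subset_left inter_subset_right
    have h2 := M.finRk_submod (A := insert y T) (B := insert s S') (U := M.E \ (S ∩ T'))
      (I := insert y (T ∩ S')) (by grind) (by grind) (by grind)
    have h3 := hM.add_le_finRk_add_finRk (A := S ∩ T') (B := M.E \ (S ∩ T')) (by grind)
      subset_rfl hb (hc.mono (by grind))
    have h5 := hw.finRk_insert (X := T ∩ S') hy hxy.symm (by grind) (by grind)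
    obtain ⟨c, hcL, hcy, hcx⟩ := hL.exists_ne y s
    have h6 := hM.add_le_finRk_add_finRk (A := T ∩ S') (B := insert y (S ∪ T')) (by grind)
      (by grind) hc (hb.mono (by grind))
    have h7 := M.finRk_insert_eq_of_subset (subset_union_left (s := S) (t := T')) hl
    omega
  have hSS' : ∀ p ∈ S, p ∈ S' → p ∈ L := by
    obtain h | h := claim1
    · exact h
    exfalso
    -- If `T` and `T'` meet only in `w`, both off-diagonal intersections keep rank at least two,
    -- against `claim2`.
    have hT1 : T ⊆ insert w (T ∩ S') := by
      have hs : s ∉ T := by grind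
      intro q hq
      have := h q hq
      grind
    have hT1' : T' ⊆ insert w (S ∩ T') := by
      have hs : y ∉ T' := by grind
      intro q hq
      have := h q
      grind
    have h1 := M.finRk_mono hT1
    have h2 := M.finRk_mono hT1'
    have h3 := M.finRk_insert_le w (T ∩ S')
    have h5 := M.finRk_insert_le w (S ∩ T')
    obtain h6 | h6 := claim2
    · exact (nontrivial_of_two_le_finRk (M := M) (by omega)).not_subsingleton h6
    · exact (nontrivial_of_two_le_finRk (M := M) (by omega)).not_subsingleton h6
  obtain h1 | h1 := claim2
  · exact hw.lobes_of_subsingleton hM h4 hL hx hy hs hxy hxs hys hv hv' hLS' (by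
      ext p; have := hSS' p; grind) h1
  · exact (hw.lobes_of_subsingleton hM h4 hL hx hs hy hxs hxy hys.symm hv' hv hLS (by
      ext p; have := hSS' p; grind) (by rwa [inter_comm])).symm

end lobes

/-! ### A line with three lobes, and the contractions it allows. -/

section structure_of_lobes

variable {M : Matroid α} [M.Finite] {X Y A S G L : Set α} {x y z g h t t' p q e : α} {c : α → α}

lemma IsLobe.finRk_compl (hg : M.IsLobe L g t) :
    M.finRk (M.E \ (L \ {g} ∪ {t})) + 1 = M.finRk M.E :=
  ((isCocircuit_iff_finRk hg.isCocircuit.subset_ground).1 hg.isCocircuit).1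

lemma IsLobe.finRk_insert_compl (hg : M.IsLobe L g t) (he : e ∈ L \ {g} ∪ {t}) :
    M.finRk (insert e (M.E \ (L \ {g} ∪ {t}))) = M.finRk M.E :=
  ((isCocircuit_iff_finRk hg.isCocircuit.subset_ground).1 hg.isCocircuit).2 e he

/-- The two complementary hyperplanes would meet in rank at most r(M) - 2. One point of `L` added to
the meet spans `L`, hence all but `t` and `t'`, which is too much for rank r(M) - 1. -/
lemma IsLobe.unique (ht : M.IsLobe L x t) (ht' : M.IsLobe L x t') (hM : M.NConnected 3)
    (h4 : 4 ≤ M.E.encard) (hL : M.IsLongLine L) (hx : x ∈ L) : t = t' := by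
  by_contra hne
  have hLE := hL.subset_ground
  have htE := ht.mem_ground
  have htE' := ht'.mem_ground
  have htL := ht.notMem
  have htL' := ht'.notMem
  obtain ⟨p, hp, hpx, -⟩ := hL.exists_ne x x
  have h1 := ht.finRk_compl
  have h2 := ht'.finRk_compl
  have h3 := ht.finRk_insert_compl (e := t) (by simp)
  have h5 := M.finRk_submod (A := M.E \ (L \ {x} ∪ {t})) (B := M.E \ (L \ {x} ∪ {t'}))
    (U := insert t (M.E \ (L \ {x} ∪ {t}))) (I := M.E \ (L \ {x} ∪ {t, t'}))
    (by grind) (by grind) (by grind)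
  have h6 := M.finRk_insert_le p (M.E \ (L \ {x} ∪ {t, t'}))
  have h7 := finRk_union_line hM h4 hLE hL.finRk_eq.le hx hp hpx.symm
    (S := insert p (M.E \ (L \ {x} ∪ {t, t'}))) (finRk_insert_of_mem (by grind))
    (finRk_insert_of_mem (by grind))
  have h8 := M.finRk_mono (show M.E \ {t, t'} ⊆ insert p (M.E \ (L \ {x} ∪ {t, t'})) ∪ L by
    intro w; simp; tauto)
  rw [hM.finRk_compl_pair h4 htE htE'] at h8
  omega

/-- With a common lobe `t`, the two hyperplanes meet in the complement of `L ∪ {t}`, of rank at most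
r(M) - 2, which makes `L` one side of a 2-separation. -/
lemma IsLobe.ne_of_ne (hg : M.IsLobe L g t) (hh : M.IsLobe L h t') (hM : M.NConnected 3)
    (h4 : 4 ≤ M.E.encard) (hr : 3 ≤ M.finRk M.E) (hL : M.IsLongLine L) (hhL : h ∈ L)
    (hgh : g ≠ h) : t ≠ t' := by
  rintro rfl
  have hLE := hL.subset_ground
  have htL := hg.notMem
  have hL2 := hL.finRk_eq
  have h1 := hg.finRk_compl
  have h2 := hh.finRk_compl
  have h3 := hg.finRk_insert_compl (e := h) (by grind)
  have h5 := M.finRk_submod (A := M.E \ (L \ {g} ∪ {t})) (B := M.E \ (L \ {h} ∪ {t}))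
    (U := insert h (M.E \ (L \ {g} ∪ {t}))) (I := M.E \ (L ∪ {t}))
    (by grind) (by grind) (by grind)
  have h6 := M.finRk_insert_le t (M.E \ (L ∪ {t}))
  have h7 := hM.add_le_finRk_add_finRk hLE (B := insert t (M.E \ (L ∪ {t}))) (by grind)
    (nontrivial_of_two_le_finRk (M := M) (by omega)) (hM.compl_nontrivial h4 (by omega))
  omega

/-- An element other than two elements with lobes lies in no triangle other than those of the
line. -/
lemma IsLobe.not_collinear (hg : M.IsLobe L g t) (hh : M.IsLobe L h t') (hM : M.NConnected 3)
    (h4 : 4 ≤ M.E.encard) (hr : 4 ≤ M.finRk M.E) (hL : M.IsLongLine L) (hgL : g ∈ L) (hhL : h ∈ L)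
    (hgh : g ≠ h) (hx : x ∈ L) (hxg : x ≠ g) (hxh : x ≠ h) (hp : p ∈ M.E) (hpL : p ∉ L)
    (hq : q ∈ M.E) (hpx : p ≠ q) (hqx : q ≠ x) : 3 ≤ M.finRk {x, p, q} := by
  by_contra! hcon
  have hLE := hL.subset_ground
  have hL2 := hL.finRk_eq
  have hqL : q ∉ L := by
    intro hqL
    have h1 := M.finRk_submod (A := {x, p, q}) (B := L) (U := insert p L) (I := {x, q})
      (by grind) (by grind) (by grind)
    have h2 := hM.finRk_pair h4 (hLE hx) (hLE hqL) hqx.symm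
    have h3 := M.finRk_mono (subset_insert p L)
    exact hpL (hL.mem_of_finRk p hp (by omega))
  have hpq := hM.finRk_pair h4 hp hq hpx
  -- The lobe cocircuit contains `x`, so it must also meet the triangle in `p` or `q`. Both lobes
  -- then lie in the plane spanned by `L` and `p`, whose complement has corank two.
  have hmem : ∀ g t, M.IsLobe L g t → g ∈ L → x ≠ g → t = p ∨ t = q := by
    intro g t hg hgL hxg
    by_contra! htpq
    have := hg.finRk_insert (X := {p, q}) hx hxg (by grind) (by grind)
    omega
  have h1 := hmem g t hg hgL hxg
  have h2 := hmem h t' hh hhL hxh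
  have h3 := hg.ne_of_ne hh hM h4 (by omega) hL hhL hgh
  have h5 := M.finRk_submod (A := {x, p, q}) (B := L) (U := L ∪ {p, q}) (I := {x})
    (by grind) (by grind) (by grind)
  rw [hM.finRk_singleton h4 (hLE hx)] at h5
  have h6 := hg.finRk_compl
  have h7 := hh.finRk_compl
  have h8 := hg.finRk_insert_compl (e := h) (by grind)
  have h9 := M.finRk_submod (A := M.E \ (L \ {g} ∪ {t})) (B := M.E \ (L \ {h} ∪ {t'}))
    (U := insert h (M.E \ (L \ {g} ∪ {t}))) (I := M.E \ (L ∪ {p, q}))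
    (by have := hh.notMem; grind) (by grind) (by grind)
  have h10 := hM.add_le_finRk_add_finRk (A := L ∪ {p, q}) (by grind) (subset_rfl)
    ⟨p, by simp, q, by simp, hpx⟩ (hM.compl_nontrivial h4 (by omega))
  omega

lemma right_eq_of_union_eq {E : Set α} (hXY : X ∪ Y = E \ {x}) (hdj : Disjoint X Y) :
    Y = E \ insert x X := by
  have : Y = (X ∪ Y) \ X := by rw [union_sdiff_left, hdj.symm.sdiff_eq_left]
  rw [this, hXY]
  grind

/-- Read in `M ／ {x}`, this excludes 1-separations. -/
lemma NConnected.add_le_finRk_insert_add (hM : M.NConnected 3) (h4 : 4 ≤ M.E.encard)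
    (hx : x ∈ M.E) (hXY : X ∪ Y = M.E \ {x}) (hdj : Disjoint X Y) (hX : X.Nonempty)
    (hY : Y.Nonempty) : M.finRk M.E + 2 ≤ M.finRk (insert x X) + M.finRk (insert x Y) := by
  obtain ⟨a, ha⟩ := hX
  obtain ⟨b, hb⟩ := hY
  have hYE := right_eq_of_union_eq hXY hdj
  have hXE := right_eq_of_union_eq (by rw [union_comm, hXY]) hdj.symm
  clear hXY hdj
  have hxX : x ∉ X := by grind
  have hxY : x ∉ Y := by grind
  obtain hX1 | hX1 := X.subsingleton_or_nontrivial
  · obtain rfl := hX1.eq_singleton_of_mem ha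
    have h1 := M.finRk_mono (show M.E \ {a} ⊆ insert x Y by grind)
    have haE : a ∈ M.E := by grind
    rw [hM.finRk_compl_singleton h4 haE] at h1
    have := hM.finRk_pair h4 hx haE (by grind)
    omega
  · have h1 := hM.add_le_finRk_add_finRk (A := X) (B := insert x Y) (by grind) (by grind) hX1
      ⟨x, by grind, b, by grind, by grind⟩
    have := M.finRk_mono (subset_insert x X)
    omega

/-- A matroid `M` with a long line `L` and lobes `c x` at three or more elements `x` of `L`. -/
structure HasLobes (M : Matroid α) (L G : Set α) (c : α → α) : Prop where
  isLongLine : M.IsLongLine L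
  subset : G ⊆ L
  card : 3 ≤ G.encard
  isLobe : ∀ x ∈ G, M.IsLobe L x (c x)

namespace HasLobes

variable (hc : M.HasLobes L G c)

include hc

lemma exists_ne (a b : α) : ∃ x ∈ G, x ≠ a ∧ x ≠ b := by
  by_contra! hcon
  have h1 : G ⊆ {a, b} := by intro x hx; simp; have := hcon x hx; tauto
  have h2 := (encard_le_encard h1).trans ((encard_insert_le _ _).trans (by
    rw [encard_singleton, one_add_one_eq_two]))
  have := hc.card.trans h2
  norm_num at this

lemma injOn (hM : M.NConnected 3) (h4 : 4 ≤ M.E.encard) (hr : 3 ≤ M.finRk M.E) : InjOn c G := by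
  intro g hg h hh hgh
  by_contra hne
  exact (hc.isLobe g hg).ne_of_ne (hc.isLobe h hh) hM h4 hr hc.isLongLine
    (hc.subset hh) hne hgh

/-- Of three lobes, two miss one side of any given separation. That side is then skew to `L`, so its
connectivity is the same in `M`, and the separation lifts to `M`. -/
lemma nConnected_contract (hM : M.NConnected 3) :
    (M ／ L).NConnected 3 := by
  have hL2 := hc.isLongLine.finRk_eq
  have hLE := hc.isLongLine.subset_ground
  have key : ∀ k < 3, ∀ A, ∀ g ∈ G, ∀ h ∈ G, g ≠ h → c g ∉ A → c h ∉ A →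
      ¬ (M ／ L).IsKSeparation k A ((M ／ L).E \ A) := by
    intro k hk A g hg h hh hgh hgA hhA hA
    have hAE : A ⊆ M.E \ L := subset_union_left.trans hA.union_eq.subset
    have h1 := (hc.isLobe g hg).finRk_union (hc.isLobe h hh) (hc.subset hg) (hc.subset hh) hgh
      (A := A) (by rw [disjoint_left]; grind) hgA hhA
    have hB : (M.E \ L) \ A ∪ L = M.E \ A := by grind
    have h2 := M.finRk_contract L A
    have h3 := M.finRk_contract L ((M.E \ L) \ A)
    have h5 := M.finRk_contract L (M.E \ L)
    rw [hB] at h3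
    rw [sdiff_union_of_subset hLE] at h5
    have h6 := hA.conn_lt
    simp only [conn, contract_ground] at h6
    refine hM k hk A (M.E \ A) ⟨disjoint_sdiff_right, union_sdiff_cancel (hAE.trans sdiff_subset),
      ?_, hA.left_card, hA.right_card.trans (encard_le_encard ?_)⟩
    · simp only [conn]
      omega
    · rw [contract_ground]
      grind
  intro k hk A B hAB
  have hB : B = (M ／ L).E \ A := by
    rw [← hAB.union_eq, union_sdiff_left, hAB.disjoint.symm.sdiff_eq_left]
  have hA : A = (M ／ L).E \ B := by
    rw [← hAB.union_eq, union_sdiff_right, hAB.disjoint.sdiff_eq_left]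
  have hBA : (M ／ L).IsKSeparation k B A := by
    refine ⟨hAB.disjoint.symm, by rw [union_comm, hAB.union_eq], ?_, hAB.right_card, hAB.left_card⟩
    have := hAB.conn_lt
    simp only [conn, ← hA, ← hB] at this ⊢
    omega
  obtain ⟨g, hg⟩ : G.Nonempty := by
    rw [← encard_pos]; exact lt_of_lt_of_le (by norm_num) hc.card
  obtain ⟨h, hh, hhg, -⟩ := hc.exists_ne g g
  obtain ⟨i, hi, hig, hih⟩ := hc.exists_ne g h
  have hnm : ∀ a, c a ∉ A ∨ c a ∉ B := fun a ↦ by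
    by_contra! h
    exact disjoint_left.1 hAB.disjoint h.1 h.2
  have h1 := fun a ha b hb hab ha1 hb1 ↦ key k hk A a ha b hb hab ha1 hb1 (hB ▸ hAB)
  have h2 := fun a ha b hb hab ha1 hb1 ↦ key k hk B a ha b hb hab ha1 hb1 (hA ▸ hBA)
  have := hnm g
  have := hnm h
  have := hnm i
  grind

/-- By `IsLobe.not_collinear`, the nontrivial parallel classes of `M ／ {x}` lie in `L`. -/
lemma subset_line (hM : M.NConnected 3) (h4 : 4 ≤ M.E.encard) (hr : 4 ≤ M.finRk M.E)
    (hx : x ∈ L) (hS : S.Nontrivial) (hSE : S ⊆ M.E \ {x}) (h2 : M.finRk (insert x S) ≤ 2) :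
    S ⊆ L := by
  intro p hp
  by_contra hpL
  obtain ⟨q, hq, hqp⟩ := hS.exists_ne p
  obtain ⟨g, hg, hgx, -⟩ := hc.exists_ne x x
  obtain ⟨h, hh, hhx, hhg⟩ := hc.exists_ne x g
  have h3 := (hc.isLobe g hg).not_collinear (hc.isLobe h hh) hM h4 hr hc.isLongLine (hc.subset hg)
    (hc.subset hh) hhg.symm hx hgx.symm hhx.symm (hSE hp).1 hpL (hSE hq).1 hqp.symm (hSE hq).2
  have := M.finRk_mono (show {x, p, q} ⊆ insert x S by grind)
  omega

lemma closure_eq {S : Set α} (hS : S ⊆ L) (hS2 : M.finRk S = 2) : M.closure S = L := by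
  have hL2 := hc.isLongLine.finRk_eq
  have hLE := hc.isLongLine.subset_ground
  ext e
  constructor
  · intro he
    have heE := M.closure_subset_ground S he
    have h1 := (mem_closure_iff_finRk heE).1 he
    have h2 := M.finRk_insert_eq_of_subset hS h1
    exact hc.isLongLine.mem_of_finRk e heE (by omega)
  · intro he
    rw [mem_closure_iff_finRk (hLE he)]
    have := M.finRk_mono (insert_subset he hS)
    have := M.finRk_mono (subset_insert e S)
    omega

lemma connectedUpToUniqueSpore (hM : M.NConnected 3) (h4 : 4 ≤ M.E.encard)
    (hr : 4 ≤ M.finRk M.E) (hx : x ∈ G) :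
    (M ／ {x}).ConnectedUpToUniqueSpore (L \ {x}) (c x) := by
  have hL := hc.isLongLine
  have hL2 := hL.finRk_eq
  have hLE := hL.subset_ground
  have hxL := hc.subset hx
  have hxE := hLE hxL
  have hl := hc.isLobe x hx
  have hcL := hl.notMem
  have hx1 := hM.finRk_singleton h4 hxE
  have hcon : ∀ X, (M ／ {x}).finRk X + 1 = M.finRk (insert x X) := fun X ↦ by
    rw [← hx1, finRk_contract, union_singleton]
  have hins : insert x (L \ {x}) = L := by rw [insert_sdiff_singleton, insert_eq_of_mem hxL]
  obtain ⟨g, hg, hgx, -⟩ := hc.exists_ne x x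
  obtain ⟨h, hh, hhx, hhg⟩ := hc.exists_ne x g
  refine ⟨⟨?_, ?_, ?_, ?_⟩, ?_, ?_⟩
  · rw [isFlat_iff_closure_eq, contract_closure_eq, union_singleton, hins,
      hc.closure_eq subset_rfl hL2]
  · have := hcon (L \ {x})
    rw [hins] at this
    rw [← cast_finRk, show (M ／ {x}).finRk (L \ {x}) = 1 by omega]
    rfl
  · exact ⟨hl.mem_ground, fun h ↦ hcL (by rw [h]; exact hxL)⟩
  · rw [contract_isCocircuit_iff]
    exact ⟨hl.isCocircuit, by rw [disjoint_left]; grind⟩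
  · rintro P s ⟨hP, hP1, hsE, hD⟩
    rw [contract_isCocircuit_iff] at hD
    have hPE : P ⊆ M.E \ {x} := hP.subset_ground
    have hxD : x ∉ P ∪ {s} := fun h ↦ disjoint_left.1 hD.2 h rfl
    rw [← cast_finRk] at hP1
    have hP1' : (M ／ {x}).finRk P = 1 := by exact_mod_cast hP1
    have hP2 := hcon P
    -- Cocircuits of `M` have at least three elements.
    have hPn : P.Nontrivial := by
      by_contra hPn
      rw [not_nontrivial_iff] at hPn
      have h1 := (isCocircuit_iff_finRk hD.1.subset_ground).1 hD.1
      obtain rfl | ⟨p, rfl⟩ := hPn.eq_empty_or_singleton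
      · rw [empty_union, hM.finRk_compl_singleton h4 hsE.1] at h1
        omega
      · rw [singleton_union, hM.finRk_compl_pair h4 (hPE rfl).1 hsE.1] at h1
        omega
    have hPL := hc.subset_line hM h4 hr hxL hPn hPE (by omega)
    have hPeq : P = L \ {x} := by
      apply (subset_sdiff_singleton hPL (fun h ↦ hxD (Or.inl h))).antisymm
      rw [← hP.closure, contract_closure_eq, union_singleton]
      rw [hc.closure_eq (insert_subset hxL hPL) (by omega)]
    refine ⟨hPeq, ?_⟩
    subst hPeq
    by_cases hsL : s ∈ L
    · have h1 := hD.1.eq_of_subset_isCircuit hl.isCocircuit (by grind)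
      have : c x ∈ L \ {x} ∪ {s} := by rw [h1]; simp
      grind
    · exact IsLobe.unique ⟨hsL, hD.1⟩ hl hM h4 hL hxL
  · intro k hk X Y hXY
    have hE : X ∪ Y = M.E \ {x} := hXY.union_eq
    have hXE : X ⊆ M.E \ {x} := hE ▸ subset_union_left
    have hYE : Y ⊆ M.E \ {x} := hE ▸ subset_union_right
    have hYX : (M.E \ {x}) \ X = Y := by
      rw [← hE, union_sdiff_left, hXY.disjoint.symm.sdiff_eq_left]
    have hconn := hXY.conn_lt
    simp only [conn, contract_ground, hYX] at hconn
    have h1 := hcon X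
    have h2 := hcon Y
    have h3 := hcon (M.E \ {x})
    rw [insert_sdiff_singleton, insert_eq_of_mem hxE] at h3
    have hk0 : 1 ≤ k := by
      have := (M ／ {x}).finRk_union_le X Y
      rw [hE] at this
      omega
    have hX : X.Nonempty := one_le_encard_iff_nonempty.1 (le_trans (by exact_mod_cast hk0)
      hXY.left_card)
    have hY : Y.Nonempty := one_le_encard_iff_nonempty.1 (le_trans (by exact_mod_cast hk0)
      hXY.right_card)
    have h5 := hM.add_le_finRk_insert_add h4 hxE hE hXY.disjoint hX hY
    obtain rfl : k = 2 := by omega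
    have hXn := two_le_encard_iff_nontrivial.1 hXY.left_card
    have hYn := two_le_encard_iff_nontrivial.1 hXY.right_card
    by_cases hX2 : M.finRk (insert x X) ≤ 2
    · exact Or.inl ((subset_sdiff_singleton (hc.subset_line hM h4 hr hxL hXn hXE hX2)
        (fun h ↦ (hXE h).2 rfl)).trans subset_union_left)
    by_cases hY2 : M.finRk (insert x Y) ≤ 2
    · exact Or.inr ((subset_sdiff_singleton (hc.subset_line hM h4 hr hxL hYn hYE hY2)
        (fun h ↦ (hYE h).2 rfl)).trans subset_union_left)
    have hYE' := right_eq_of_union_eq hE hXY.disjoint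
    clear hYX
    have h6 := hM.add_le_finRk_add_finRk (A := X) (B := insert x Y) (by grind) (by grind) hXn
      (hYn.mono (by grind))
    have h7 := M.finRk_mono (subset_insert x X)
    have hv : M.IsVerticalPartition X x Y := .of_le hM hxE (by grind) (by grind) (by grind)
      (by omega) (by omega) (by omega) (by omega)
    -- Once `L` is moved to the side of `g`, the lobes at `g` and `h` leave room for only one
    -- further element there, and uniqueness of lobes identifies it as `c x`.
    have key : ∀ X Y, M.IsVerticalPartition X x Y → g ∈ X → X ⊆ L \ {x} ∪ {c x} := by
      intro X Y hv hgX
      have hv' := hv.union_line hM h4 hL hxL (hc.subset hg) hgX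
      obtain ⟨b, hbL, hb⟩ := hv'.exists_eq hM h4 hL hxL subset_union_right (hc.isLobe g hg)
        (hc.isLobe h hh) (hc.subset hg) (hc.subset hh) hhg.symm hgx.symm hhx.symm
      rw [hb] at hv'
      rw [hl.unique (hv'.isLobe hM h4 hxL hLE hL2.le hbL).2 hM h4 hL hxL, ← hb]
      exact subset_union_left
    obtain hgX | hgX | hgY := hv.mem_or (hLE (hc.subset hg))
    · exact Or.inl (key X Y hv hgX)
    · exact absurd hgX hgx
    · exact Or.inr (key Y X hv.symm hgY)

end HasLobes

end structure_of_lobes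

/-! ### Minimal vertical partitions and the first lobe. -/

section minimal

variable {M : Matroid α} [M.Finite] {C X Y A B S T L : Set α} {x y z t e : α}

/-- A vertical `3`-partition with guts in `C` whose right side, together with the guts, is minimal
among such partitions. -/
structure IsMinimalPartition (M : Matroid α) (C X : Set α) (z : α) (Y : Set α) : Prop where
  isVerticalPartition : M.IsVerticalPartition X z Y
  mem : z ∈ C
  minimal : ∀ X' z' Y', M.IsVerticalPartition X' z' Y' → z' ∈ C → insert z' Y' ⊆ insert z Y →
    insert z' Y' = insert z Y

/-- An element of `Y` spanned by `X` could be moved to the left, shrinking the right side. -/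
lemma IsVerticalPartition.finRk_insert_of_minimal (hv : M.IsVerticalPartition X z Y)
    (hmin : ∀ X' Y', M.IsVerticalPartition X' z Y' → Y' ⊆ Y → insert z Y' = insert z Y)
    (hM : M.NConnected 3) (h4 : 4 ≤ M.E.encard) (hy : y ∈ Y) :
    M.finRk (insert y X) = M.finRk X + 1 := by
  by_contra hcon
  have h1 := M.finRk_insert_le y X
  have h2 := M.finRk_mono (subset_insert y X)
  have hzY := hv.notMem_right
  have h3 := hv.union_left hM h4 (A := {y}) (by simpa using hv.right_subset hy)
    (by rintro rfl; exact hzY hy) (by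
      rintro a rfl
      omega)
  have h5 := hmin _ _ h3 sdiff_subset
  have : y ∈ insert z (Y \ {y}) := by rw [h5]; grind
  grind

namespace IsMinimalPartition

lemma finRk_insert (h : M.IsMinimalPartition C X z Y) (hM : M.NConnected 3)
    (h4 : 4 ≤ M.E.encard) (hy : y ∈ Y) : M.finRk (insert y X) = M.finRk X + 1 :=
  h.isVerticalPartition.finRk_insert_of_minimal
    (fun _ _ h' hss ↦ h.minimal _ _ _ h' h.mem (insert_subset_insert hss)) hM h4 hy

/-- Crossing a minimal partition with a vertical partition at another element of `C`. -/
lemma exists_line_or_cover (h : M.IsMinimalPartition C X z Y) (hM : M.NConnected 3)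
    (h4 : 4 ≤ M.E.encard) (hy : y ∈ Y) (hyC : y ∈ C) (hst : M.IsVerticalPartition S y T) :
    (∃ L t, M.IsLongLine L ∧ L ⊆ insert z Y ∧ y ∈ L ∧ M.IsLobe L y t) ∨
    ∃ A B, A ∪ B = insert z Y ∧ y ∈ A ∧ y ∈ B ∧ z ∈ B ∧ z ∉ A ∧ M.finRk A ≤ 2 ∧
      M.finRk B ≤ 2 := by
  have hv := h.isVerticalPartition
  have hcl := h.finRk_insert hM h4 hy
  wlog hzS : z ∈ S generalizing S T
  · refine this hst.symm ?_
    have := hst.mem_or hv.mem_ground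
    have := hv.notMem_right
    grind
  have hYE := hv.right_eq
  have hXE := hv.left_subset
  have hTE := hst.right_eq
  have hSE := hst.left_subset
  have hzX := hv.notMem_left
  have hyS := hst.notMem_left
  have hzE := hv.mem_ground
  have hyE := hst.mem_ground
  have hl := hv.left_span
  have hr := hv.right_span
  have hl' := hst.left_span
  have hr' := hst.right_span
  have hX3 := hv.left_rank
  have hY3 := hv.right_rank
  have hS3 := hst.left_rank
  have hT3 := hst.right_rank
  have hXY := hv.rank_add
  have hST := hst.rank_add
  -- If `X` and `S` were disjoint, minimality would give `T = X`, and `X` would span `y`.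
  obtain ⟨p, hpX, hpS⟩ : (X ∩ S).Nonempty := by
    by_contra hcon
    rw [not_nonempty_iff_eq_empty] at hcon
    have hsub : insert y S ⊆ insert z Y := by
      intro a ha
      have : a ∉ X ∩ S := by rw [hcon]; simp
      grind
    have h1 := h.minimal _ _ _ hst.symm hyC hsub
    have : T = X := by
      ext a
      have : a ∈ insert y S ↔ a ∈ insert z Y := by rw [h1]
      grind
    rw [this] at hr'
    omega
  -- Otherwise uncrossing gives the vertical partition `(X ∪ S, y, Y ∩ T)`, whose smaller right side
  -- contradicts minimality.
  have hA : M.finRk (insert y (Y ∩ T)) ≤ 2 := by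
    by_contra! hA
    have h1 := M.finRk_submod (A := Y) (B := insert y T) (U := Y ∪ T) (I := insert y (Y ∩ T))
      (by grind) (by grind) (by grind)
    have h2 := M.finRk_submod (A := insert z X) (B := S) (U := X ∪ S) (I := insert z (X ∩ S))
      (by grind) (by grind) (by grind)
    have h3 := hM.add_le_finRk_add_finRk (A := Y ∪ T) (B := insert z (X ∩ S)) (by grind) (by grind)
      ((nontrivial_of_two_le_finRk (M := M) (X := Y) (by omega)).mono subset_union_left)
      ⟨p, by grind, z, by grind, by grind⟩
    have h5 : M.IsVerticalPartition (X ∪ S) y (Y ∩ T) := by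
      have h6 := M.finRk_mono (subset_union_left (s := X) (t := S))
      exact .of_le hM hyE (by grind) (by grind) (by grind)
        (M.finRk_insert_eq_of_subset subset_union_right hl') (by omega) hA (by omega)
    have h6 := h.minimal _ _ _ h5 hyC (by grind)
    have : z ∈ insert y (Y ∩ T) := by rw [h6]; grind
    grind
  obtain hs | hn := (X ∩ T).subsingleton_or_nontrivial
  · left
    obtain ⟨t, ht⟩ : (X ∩ T).Nonempty := by
      by_contra hcon
      rw [not_nonempty_iff_eq_empty] at hcon
      have h1 := M.finRk_mono (show T ⊆ insert y (Y ∩ T) by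
        intro a ha
        have : a ∉ X ∩ T := by rw [hcon]; simp
        grind)
      omega
    have hteq := hs.eq_singleton_of_mem ht
    have hTeq : T = insert y (Y ∩ T) \ {y} ∪ {t} := by
      ext a
      have : a ∈ X ∩ T ↔ a = t := by rw [hteq]; simp
      grind
    obtain ⟨h1, h2⟩ := IsVerticalPartition.isLobe (hTeq ▸ hst.symm) hM h4 (mem_insert y _)
      (by grind) hA (by grind)
    exact ⟨_, t, h1, by grind, mem_insert y _, h2⟩
  · right
    refine ⟨insert y (Y ∩ T), insert z (insert y (Y ∩ S)), by grind, by grind, by grind, by grind,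
      by grind, hA, ?_⟩
    -- Otherwise `(insert z (X ∪ T), y, Y ∩ S)` is a vertical partition that contradicts minimality.
    by_contra! hB
    have h1 := M.finRk_submod (A := insert z Y) (B := insert y S) (U := Y ∪ S)
      (I := insert z (insert y (Y ∩ S))) (by grind) (by grind) (by grind)
    have h2 := M.finRk_submod (A := X) (B := T) (U := X ∪ T) (I := X ∩ T) subset_rfl
      inter_subset_left inter_subset_right
    have h3 := hM.add_le_finRk_add_finRk (A := X ∩ T) (B := Y ∪ S) (by grind) (by grind) hn
      ⟨y, by grind, z, by grind, by grind⟩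
    have h5 := M.finRk_insert_eq_of_subset (subset_union_left (s := X) (t := T)) hl
    have h6 := M.finRk_insert_eq_of_subset
      (show T ⊆ insert z (X ∪ T) by grind) hr'
    have h7 := M.finRk_mono (show X ⊆ insert z (X ∪ T) by grind)
    have h8 : Y ∩ S = M.E \ insert y (insert z (X ∪ T)) := by grind
    -- Rank three must survive the removal of `z`: 3-connectivity shows that `Y ∩ S` alone already
    -- has the full rank.
    have h9 : M.finRk (insert y (Y ∩ S)) = M.finRk (insert z (insert y (Y ∩ S))) := by
      have hle := M.finRk_mono (show insert y (Y ∩ S) ⊆ insert z (insert y (Y ∩ S)) by grind)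
      have hle' := M.finRk_mono (subset_insert y (Y ∩ S))
      obtain hs' | hn' := (Y ∩ S).subsingleton_or_nontrivial
      · exfalso
        obtain hemp | ⟨s, hs⟩ := hs'.eq_empty_or_singleton
        · rw [hemp] at hB
          have := M.finRk_insert_le z {y}
          have := M.finRk_singleton_le y
          simp only [insert_empty_eq] at hB
          omega
        · have hsm : s ∈ Y ∩ S := by rw [hs]; rfl
          have h10 := M.finRk_mono (show M.E \ {s} ⊆ insert y (insert z (X ∪ T)) by
            intro a ha
            have : a ∈ Y ∩ S ↔ a = s := by rw [hs]; simp
            grind)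
          rw [hM.finRk_compl_singleton h4 (by grind)] at h10
          omega
      · have h10 := hM.add_le_finRk_add_finRk (A := Y ∩ S) (B := insert y (insert z (X ∪ T)))
          (by grind) (by grind) hn' (hn.mono (by grind))
        omega
    have h10 : M.IsVerticalPartition (insert z (X ∪ T)) y (Y ∩ S) :=
      .of_le hM hyE h8 (by grind) (by grind) h6 (by omega) (by omega) (by omega)
    have h11 := h.minimal _ _ _ h10 hyC (by grind)
    have : z ∈ insert y (Y ∩ S) := by rw [h11]; grind
    grind

/-- If every element of `C` in the right side of a minimal partition has a vertical partition,
then this side yields a line with a lobe. -/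
lemma exists_isLobe (h : M.IsMinimalPartition C X z Y) (hM : M.NConnected 3)
    (h4 : 4 ≤ M.E.encard) (hC : M.IsCocircuit C)
    (hvC : ∀ y ∈ Y, y ∈ C → ∃ S T, M.IsVerticalPartition S y T) :
    ∃ L x t, M.IsLongLine L ∧ L ⊆ insert z Y ∧ x ∈ L ∧ x ∈ C ∧ M.IsLobe L x t := by
  by_contra hno
  have hv := h.isVerticalPartition
  have hYE := hv.right_eq
  have hzE := hv.mem_ground
  have hzY := hv.notMem_right
  have hY3 := hv.right_rank
  have hcov : ∀ y ∈ Y, y ∈ C → ∃ A B, A ∪ B = insert z Y ∧ y ∈ A ∧ y ∈ B ∧ z ∈ B ∧ z ∉ A ∧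
      M.finRk A ≤ 2 ∧ M.finRk B ≤ 2 := by
    intro y hy hyC
    obtain ⟨S, T, hst⟩ := hvC y hy hyC
    obtain ⟨L, t, h1, h2, h3, h5⟩ | h' := h.exists_line_or_cover hM h4 hy hyC hst
    · exact absurd ⟨L, y, t, h1, h2, h3, hyC, h5⟩ hno
    · exact h'
  -- `Y` spans `z`, which lies in the cocircuit `C`, so `C` must meet `Y`.
  obtain ⟨y, hy, hyC⟩ : ∃ y ∈ Y, y ∈ C := by
    by_contra! hcon
    have := hC.finRk_insert h.mem (disjoint_left.2 hcon)
    have := hv.right_span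
    omega
  obtain ⟨A, B, hAB, hyA, hyB, hzB, hzA, hA2, hB2⟩ := hcov y hy hyC
  have hm : ∀ a, a ∈ A ∨ a ∈ B ↔ a = z ∨ a ∈ Y := fun a ↦ by
    rw [← mem_union, hAB]; simp
  have hABE : ∀ a, a ∈ A ∨ a ∈ B → a ∈ M.E := by grind
  have hYAB := M.finRk_mono (show Y ⊆ A ∪ B from fun a ha ↦ (hm a).2 (Or.inr ha))
  -- If such a `w` were in `C`, it would give a second cover. Its `B'` meets `B` only in `z`, so
  -- `A'` contains `y`, `w` and some `s` of `B` off the line of `A`, exceeding rank two.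
  have key : ∀ w ∈ Y \ B, w ∉ C := by
    intro w hw hwC
    obtain ⟨A', B', hAB', hwA', hwB', hzB', hzA', hA2', hB2'⟩ := hcov w hw.1 hwC
    have hm' : ∀ a, a ∈ A' ∨ a ∈ B' ↔ a = z ∨ a ∈ Y := fun a ↦ by
      rw [← mem_union, hAB']; simp
    have hwA : w ∈ A := by have := hm w; grind
    have hwE : w ∈ M.E := hABE w (Or.inl hwA)
    have hyE : y ∈ M.E := hABE y (Or.inl hyA)
    have hyw : y ≠ w := by grind
    have hywr := hM.finRk_pair h4 hyE hwE hyw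
    have hne : ∀ p ∈ B, p ≠ z → p ∉ B' := by
      intro p hp hpz hpB'
      have h1 := M.finRk_submod (A := B') (B := B) (U := insert w B) (I := {p, z}) (by grind)
        (by grind) (by grind)
      rw [hM.finRk_pair h4 (hABE p (Or.inr hp)) hzE hpz] at h1
      have h2 := M.finRk_submod (A := A) (B := insert w B) (U := A ∪ B) (I := {y, w}) (by grind)
        (by grind) (by grind)
      omega
    have hyA' : y ∈ A' := by
      have := hne y hyB (by grind)
      have := hm' y
      grind
    obtain ⟨s, hsB, hsz, hsA⟩ : ∃ s ∈ B, s ≠ z ∧ M.finRk (insert s A) ≠ M.finRk A := by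
      by_contra! hcon
      have h1 := finRk_union_eq_of_forall M (X := A) (Y := B \ {z}) fun e he ↦ hcon e he.1 he.2
      have h2 := M.finRk_mono (show Y ⊆ A ∪ B \ {z} by
        intro a ha
        have := hm a
        grind)
      omega
    have hsA' : s ∈ A' := by
      have := hne s hsB hsz
      have := hm' s
      have := hm s
      grind
    have h1 := M.finRk_submod (A := A') (B := A) (U := insert s A) (I := {y, w}) (by grind)
      (by grind) (by grind)
    have h2 := M.finRk_mono (subset_insert s A)
    have h3 := M.finRk_mono (show {y, w} ⊆ A by grind)
    omega
  obtain ⟨w, hw⟩ : (Y \ B).Nonempty := by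
    by_contra hcon
    rw [not_nonempty_iff_eq_empty, sdiff_eq_empty] at hcon
    have := M.finRk_mono hcon
    omega
  -- Two such points lie outside `C` on a line of `A` through `y` in `C`, which a cocircuit forbids.
  -- So `Y` is `B \ {z}` and one more point, a lobe of `B` at `z`.
  have huniq : ∀ w' ∈ Y \ B, w' = w := by
    intro w' hw'
    by_contra hne
    have h1 := hC.finRk_insert (e := y) (X := {w, w'}) hyC (by
      rw [disjoint_left]
      have := key w hw
      have := key w' hw'
      grind)
    rw [hM.finRk_pair h4 (by grind) (by grind) (Ne.symm hne)] at h1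
    have h2 := M.finRk_mono (show insert y {w, w'} ⊆ A by
      have := hm w
      have := hm w'
      grind)
    omega
  have hYeq : Y = B \ {z} ∪ {w} := by
    ext a
    have := huniq a
    have := hm a
    grind
  obtain ⟨h1, h2⟩ := IsVerticalPartition.isLobe (hYeq ▸ hv.symm) hM h4 hzB
    (fun a ha ↦ hABE a (Or.inr ha)) hB2 hw.2
  exact hno ⟨B, z, w, h1, hAB ▸ subset_union_right, hzB, h.mem, h2⟩

end IsMinimalPartition

end minimal

/-! ### From lobes to segment-cosegment pairs. -/

section triangles

variable {M : Matroid α} [M.Finite] {L G T : Set α} {c : α → α}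

lemma IsLongLine.isTriangle (hL : M.IsLongLine L) (hM : M.NConnected 3) (h4 : 4 ≤ M.E.encard)
    (hT : T ⊆ L) (h3 : T.encard = 3) : M.IsTriangle T := by
  refine ⟨?_, h3⟩
  have hTE := hT.trans hL.subset_ground
  have hTf := M.ground_finite.subset hTE
  rw [isCircuit_iff_dep_forall_sdiff_singleton_indep]
  constructor
  · rw [← not_indep_iff hTE]
    intro hi
    have h1 := M.finRk_mono hT
    rw [hL.finRk_eq, (indep_iff_finRk hTf).1 hi] at h1
    have h2 : (T.ncard : ℕ∞) = 3 := by rw [hTf.cast_ncard_eq, h3]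
    have : T.ncard = 3 := by exact_mod_cast h2
    omega
  · intro e he
    have h2 : (T \ {e}).encard = 2 := by
      have := encard_sdiff_singleton_add_one he
      rw [h3, ← two_add_one_eq_three] at this
      exact ENat.add_left_injective_of_ne_top ENat.one_ne_top this
    obtain ⟨a, b, hab, hTab⟩ := encard_eq_two.1 h2
    have haT : a ∈ T \ {e} := by rw [hTab]; simp
    have hbT : b ∈ T \ {e} := by rw [hTab]; simp
    rw [hTab, indep_iff_finRk (by simp), ncard_pair hab,
      hM.finRk_pair h4 (hTE haT.1) (hTE hbT.1) hab]

lemma HasLobes.closure_subset_eq (hc : M.HasLobes L G c) (hM : M.NConnected 3)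
    (h4 : 4 ≤ M.E.encard) : M.closure G = L := by
  refine hc.closure_eq hc.subset ?_
  obtain ⟨a, ha⟩ : G.Nonempty := by
    rw [← encard_pos]; exact lt_of_lt_of_le (by norm_num) hc.card
  obtain ⟨b, hb, hba, -⟩ := hc.exists_ne a a
  have h1 := M.finRk_mono (pair_subset ha hb)
  have h2 := M.finRk_mono hc.subset
  have hLE := hc.isLongLine.subset_ground
  rw [hM.finRk_pair h4 (hLE (hc.subset ha)) (hLE (hc.subset hb)) hba.symm] at h1
  rw [hc.isLongLine.finRk_eq] at h2
  omega

lemma HasLobes.isSegmentCosegmentPair (hc : M.HasLobes L G c) (hM : M.NConnected 3)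
    (h4 : 4 ≤ M.E.encard) (hr : 3 ≤ M.finRk M.E) : M.IsSegmentCosegmentPair G (c '' G) c where
  isSegment := ⟨hc.card, fun _ hT h3 ↦ hc.isLongLine.isTriangle hM h4 (hT.trans hc.subset) h3⟩
  bijOn := (hc.injOn hM h4 hr).bijOn_image
  disjoint := by
    rw [disjoint_right]
    rintro _ ⟨x, hx, rfl⟩ h
    exact (hc.isLobe x hx).notMem (hc.subset h)
  isCocircuit x hx := by
    rw [hc.closure_subset_eq hM h4]
    exact (hc.isLobe x hx).isCocircuit

end triangles

/-! ### Keeping an N-minor while contracting. -/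

section minors

variable {M : Matroid α} [M.Finite] {N : Matroid β} [N.Finite] {f : β → α} {I X Y L J C : Set α}
  {x z t : α}

lemma contract_singleton_finRk (hM : M.NConnected 3) (h4 : 4 ≤ M.E.encard) (hz : z ∈ M.E)
    (X : Set α) : (M ／ {z}).finRk X + 1 = M.finRk (insert z X) := by
  rw [← hM.finRk_singleton h4 hz, finRk_contract, union_singleton]

lemma contract_singleton_finRk_ground (hM : M.NConnected 3) (h4 : 4 ≤ M.E.encard) (hz : z ∈ M.E) :
    (M ／ {z}).finRk (M ／ {z}).E + 1 = M.finRk M.E := by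
  rw [contract_singleton_finRk hM h4 hz, contract_ground, insert_sdiff_singleton,
    insert_eq_of_mem hz]

/-- The version of `IsRankMinor.exists_contract` for a separation of `M / z`. -/
lemma IsRankMinor.exists_contract_of_mem (h : M.IsRankMinor N f I) (hM : M.NConnected 3)
    (h4 : 4 ≤ M.E.encard) (hN : N.NConnected 3) (hN4 : 4 ≤ N.E.encard) (hzI : z ∈ I)
    (hXY : X ∪ Y = M.E \ {z}) (hdj : Disjoint X Y)
    (hr : M.finRk (insert z X) + M.finRk (insert z Y) = M.finRk M.E + 2) (hJY : J ⊆ Y)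
    (hJ : M.finRk (insert z X ∪ J) + 1 = M.finRk (insert z X) + M.finRk (insert z J))
    (hsub : (N.E ∩ f ⁻¹' Y).Subsingleton) :
    ∃ f' I', M.IsRankMinor N f' I' ∧ insert z J ⊆ I' ∧ (N.E ∩ f' ⁻¹' Y).Subsingleton := by
  have hz := h.subset_ground hzI
  have hN1 := fun e he ↦ hN.finRk_singleton (e := e) hN4 he
  have hcon := contract_singleton_finRk hM h4 hz
  have hE := contract_singleton_finRk_ground hM h4 hz
  have h1 := hcon X
  have h2 := hcon Y
  have h3 := hcon (X ∪ J)
  have h5 := hcon J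
  rw [← insert_union] at h3
  obtain ⟨f', I', h', hJI, hs⟩ := (h.contract (singleton_subset_iff.2 hzI) hN1).exists_contract
    (A := X) (B := Y) hXY hdj (by omega) hJY (by omega) hsub hN1
    (fun e he ↦ hN.finRk_compl_singleton hN4 he)
  exact ⟨f', I' ∪ {z}, h'.of_contract (singleton_subset_iff.2 hz), by grind, hs⟩

lemma IsRankMinor.subsingleton_or_of_mem (h : M.IsRankMinor N f I) (hM : M.NConnected 3)
    (h4 : 4 ≤ M.E.encard) (hN : N.NConnected 3) (hN4 : 4 ≤ N.E.encard) (hzI : z ∈ I)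
    (hXY : X ∪ Y = M.E \ {z}) (hdj : Disjoint X Y)
    (hr : M.finRk (insert z X) + M.finRk (insert z Y) = M.finRk M.E + 2) :
    (N.E ∩ f ⁻¹' X).Subsingleton ∨ (N.E ∩ f ⁻¹' Y).Subsingleton := by
  have hz := h.subset_ground hzI
  have hN1 := fun e he ↦ hN.finRk_singleton (e := e) hN4 he
  have hE := contract_singleton_finRk_ground hM h4 hz
  have h1 := contract_singleton_finRk hM h4 hz X
  have h2 := contract_singleton_finRk hM h4 hz Y
  exact (h.contract (singleton_subset_iff.2 hzI) hN1).subsingleton_or_subsingleton hN hXY hdj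
    (by omega)

lemma IsRankMinor.hasMinor_contract (h : M.IsRankMinor N f I) (hN : N.NConnected 3)
    (hN4 : 4 ≤ N.E.encard) (hJ : J ⊆ I) : (M ／ J).HasMinor N :=
  (h.contract hJ fun _ he ↦ hN.finRk_singleton hN4 he).hasMinor
    (fun _ he ↦ hN.finRk_singleton hN4 he) (fun _ he _ he' hne ↦ hN.finRk_pair hN4 he he' hne)

lemma IsRankMinor.hasMinor_si_contract (h : M.IsRankMinor N f I) (hN : N.NConnected 3)
    (hN4 : 4 ≤ N.E.encard) (hJ : J ⊆ I) : (M ／ J).si.HasMinor N :=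
  ((h.contract hJ fun _ he ↦ hN.finRk_singleton hN4 he).si
    fun _ he ↦ hN.finRk_singleton hN4 he).hasMinor
    (fun _ he ↦ hN.finRk_singleton hN4 he) (fun _ he _ he' hne ↦ hN.finRk_pair hN4 he he' hne)

/-- If `L` has a lobe at `x` and `M / x` has an `N`-minor, then so does `M / L`. -/
lemma IsLobe.exists_isRankMinor (hl : M.IsLobe L x t) (h : M.IsRankMinor N f I)
    (hM : M.NConnected 3) (h4 : 4 ≤ M.E.encard) (hN : N.NConnected 3) (hN4 : 4 ≤ N.E.encard)
    (hL : M.IsLongLine L) (hx : x ∈ L) (hxI : x ∈ I) :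
    ∃ f' I', M.IsRankMinor N f' I' ∧ L ⊆ I' := by
  have hLE := hL.subset_ground
  have hL2 := hL.finRk_eq
  have htE := hl.mem_ground
  have htL := hl.notMem
  set S := M.E \ (L ∪ {t}) with hS
  set T := L \ {x} ∪ {t} with hT
  have hST : S ∪ T = M.E \ {x} := by
    have := hLE hx
    ext a
    have : a ∈ L → a ∈ M.E := fun h ↦ hLE h
    have : a = t → a ∈ M.E := by rintro rfl; exact htE
    simp only [hS, hT]
    grind
  have hdj : Disjoint S T := by rw [disjoint_left]; grind
  have hxS : insert x S = M.E \ T := by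
    have := hLE hx
    grind
  have h1 := hl.finRk_compl
  rw [← hT, ← hxS] at h1
  have hxT : insert x T = insert t L := by grind
  have h2 : M.finRk (insert t L) = 3 := by
    have h3 := M.finRk_insert_le t L
    have h5 := M.finRk_mono (subset_insert t L)
    by_contra hcon
    exact htL (hL.mem_of_finRk t htE (by omega))
  have hr : M.finRk (insert x S) + M.finRk (insert x T) = M.finRk M.E + 2 := by
    rw [hxT]; omega
  -- Otherwise `N` has at most one element in `S`, one in `L` (of rank at most one after contracting
  -- `x`) and one at `t`, fewer than four.
  have hsub : (N.E ∩ f ⁻¹' T).Subsingleton := by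
    refine (h.subsingleton_or_of_mem hM h4 hN hN4 hxI hST hdj hr).resolve_left fun hsS ↦ ?_
    have hN1 := fun e he ↦ hN.finRk_singleton (e := e) hN4 he
    have hinj := h.injOn fun e he e' he' hne ↦ hN.finRk_pair hN4 he he' hne
    have hsL : (N.E ∩ f ⁻¹' L).Subsingleton := by
      intro e he e' he'
      by_contra hne
      have h3 := h.finRk_eq {e, e'} (pair_subset he.1 he'.1)
      rw [hN.finRk_pair hN4 he.1 he'.1 hne, image_pair] at h3
      have h5 := M.finRk_submod (A := L) (B := I) (U := {f e, f e'} ∪ I) (I := {x})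
        (by have := he.2; have := he'.2; grind) (by grind) (by grind)
      rw [hM.finRk_singleton h4 (hLE hx)] at h5
      omega
    have hst : (N.E ∩ f ⁻¹' {t}).Subsingleton := fun e he e' he' ↦
      hinj he.1 he'.1 (he.2.trans he'.2.symm)
    have hcov : N.E ⊆ ((N.E ∩ f ⁻¹' S) ∪ (N.E ∩ f ⁻¹' L)) ∪ (N.E ∩ f ⁻¹' {t}) := by
      intro e he
      have := h.image_subset (mem_image_of_mem f he)
      simp only [hS]
      grind
    have h3 := hN4.trans ((encard_le_encard hcov).trans ((encard_union_le _ _).trans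
      (add_le_add ((encard_union_le _ _).trans (add_le_add
        (encard_le_one_iff_subsingleton.2 hsS) (encard_le_one_iff_subsingleton.2 hsL)))
        (encard_le_one_iff_subsingleton.2 hst))))
    norm_num at h3
  have hins : insert x (L \ {x}) = L := by rw [insert_sdiff_singleton, insert_eq_of_mem hx]
  -- This says that `L \ {x}` is skew to `S` in `M ／ {x}`, as rerouting requires.
  have h3 : M.finRk (insert x S ∪ L \ {x}) = M.finRk M.E := by
    apply le_antisymm (M.finRk_le_ground _)
    rw [← hM.finRk_compl_singleton h4 htE]
    refine M.finRk_mono ?_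
    rw [hxS]
    intro a
    simp only [hT]
    grind
  obtain ⟨f', I', h', hsub', -⟩ := h.exists_contract_of_mem hM h4 hN hN4 hxI hST hdj hr
    (J := L \ {x}) (by grind) (by rw [hins]; omega) hsub
  exact ⟨f', I', h', hins ▸ hsub'⟩

/-- A minimal partition among those whose right side meets some `N`-minor in at most one
element; the elements of `C` in its right side can all be contracted keeping an `N`-minor. -/
lemma IsRankMinor.exists_isMinimalPartition (h : M.IsRankMinor N f I)
    (hM : M.NConnected 3) (h4 : 4 ≤ M.E.encard) (hN : N.NConnected 3) (hN4 : 4 ≤ N.E.encard)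
    (hx : x ∈ C) (hxI : x ∈ I) (hv : M.IsVerticalPartition X x Y) :
    ∃ X z Y, M.IsMinimalPartition C X z Y ∧
      ∀ y ∈ insert z Y, ∃ f I, M.IsRankMinor N f I ∧ y ∈ I := by
  wlog hsub : (N.E ∩ f ⁻¹' Y).Subsingleton generalizing X Y
  · refine this hv.symm ((h.subsingleton_or_of_mem hM h4 hN hN4 hxI hv.union_eq hv.disjoint ?_
      ).resolve_right hsub)
    rw [hv.left_span, hv.right_span, hv.rank_add]
  -- The minor is quantified anew for each partition, since one that contracts `z` need not contract
  -- another guts.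
  set 𝒲 := {W | ∃ X z Y, W = insert z Y ∧ M.IsVerticalPartition X z Y ∧ z ∈ C ∧
    ∃ f I, M.IsRankMinor N f I ∧ z ∈ I ∧ (N.E ∩ f ⁻¹' Y).Subsingleton} with h𝒲
  have hfin : 𝒲.Finite := by
    refine M.ground_finite.finite_subsets.subset ?_
    rintro _ ⟨X, z, Y, rfl, hv, -⟩
    exact insert_subset hv.mem_ground hv.right_subset
  obtain ⟨W, hW⟩ := hfin.exists_minimal ⟨_, X, x, Y, rfl, hv, hx, f, I, h, hxI, hsub⟩
  obtain ⟨⟨X, z, Y, rfl, hv, hz, f, I, h, hzI, hsub⟩, hmin⟩ := hW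
  have hzY := hv.notMem_right
  have hcl : ∀ y ∈ Y, M.finRk (insert y X) = M.finRk X + 1 := by
    intro y hy
    refine hv.finRk_insert_of_minimal (fun X' Y' hv' hss ↦ ?_) hM h4 hy
    have hss' := insert_subset_insert (a := z) hss
    exact hss'.antisymm (hmin ⟨X', z, Y', rfl, hv', hz, f, I, h, hzI,
      hsub.anti (inter_subset_inter_right _ (preimage_mono hss))⟩ hss')
  have hgood : ∀ y ∈ Y, ∃ f I, M.IsRankMinor N f I ∧ y ∈ I ∧ z ∈ I ∧
      (N.E ∩ f ⁻¹' Y).Subsingleton := by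
    intro y hy
    have hyE := hv.right_subset hy
    obtain ⟨f', I', h', hsI, hs⟩ := h.exists_contract_of_mem hM h4 hN hN4 hzI hv.union_eq
      hv.disjoint (by rw [hv.left_span, hv.right_span, hv.rank_add]) (J := {y}) (by simpa) (by
        rw [hM.finRk_pair h4 hv.mem_ground hyE (by rintro rfl; exact hzY hy), union_singleton,
          insert_comm, M.finRk_insert_eq_of_subset (subset_insert y X) hv.left_span, hcl y hy,
          hv.left_span]) hsub
    exact ⟨f', I', h', hsI (by simp), hsI (by simp), hs⟩
  refine ⟨X, z, Y, ⟨hv, hz, fun X' z' Y' hv' hz' hss ↦ ?_⟩, ?_⟩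
  · refine hss.antisymm (hmin ⟨X', z', Y', rfl, hv', hz', ?_⟩ hss)
    have hzY' := hv'.notMem_right
    obtain rfl | hzz := eq_or_ne z' z
    · refine ⟨f, I, h, hzI, hsub.anti (inter_subset_inter_right _ (preimage_mono ?_))⟩
      grind
    -- This minor contracts `z` as well as `z'`, so its elements in `Y'`, a subset of `insert z Y`,
    -- all lie in `Y`.
    · obtain ⟨f', I', h', hzI', hzI'', hs⟩ := hgood z' (by grind)
      refine ⟨f', I', h', hzI', ?_⟩
      have hdj := h'.disjoint fun e he ↦ hN.finRk_singleton hN4 he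
      refine hs.anti fun e he ↦ ⟨he.1, ?_⟩
      have : f' e ∈ insert z Y := hss (mem_insert_of_mem _ he.2)
      refine this.resolve_left fun hfz ↦ ?_
      exact disjoint_left.1 hdj hzI'' (hfz ▸ mem_image_of_mem f' he.1)
  · rintro y (rfl | hy)
    · exact ⟨f, I, h, hzI⟩
    · obtain ⟨f', I', h', hyI, -⟩ := hgood y hy
      exact ⟨f', I', h', hyI⟩

end minors

/-! ### Assembling the cases. -/

section main

variable {M : Matroid α} [M.Finite] {N : Matroid β} [N.Finite] {f : β → α} {I L G C : Set α}
  {x e e' t : α}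

/-- A line meeting a cocircuit has at most one element outside it. -/
lemma IsLongLine.eq_of_notMem (hL : M.IsLongLine L) (hM : M.NConnected 3) (h4 : 4 ≤ M.E.encard)
    (hC : M.IsCocircuit C) (hx : x ∈ L) (hxC : x ∈ C) (he : e ∈ L \ C) (he' : e' ∈ L \ C) :
    e = e' := by
  by_contra hne
  have hLE := hL.subset_ground
  have h1 := hC.finRk_insert hxC (X := {e, e'}) (by
    rw [disjoint_left]; rintro a (rfl | rfl); exacts [he.2, he'.2])
  rw [hM.finRk_pair h4 (hLE he.1) (hLE he'.1) hne] at h1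
  have h2 := M.finRk_mono (insert_subset hx (pair_subset he.1 he'.1))
  rw [hL.finRk_eq] at h2
  omega

/-- If every other element of a set `G` of at least three points of `L` is the guts of a vertical
`3`-partition, then a lobe at one point of `G` yields lobes at all of them. -/
lemma IsLobe.exists_hasLobes (hl : M.IsLobe L x t) (hM : M.NConnected 3) (h4 : 4 ≤ M.E.encard)
    (hL : M.IsLongLine L) (hG : G ⊆ L) (hG3 : 3 ≤ G.encard) (hx : x ∈ G)
    (hv : ∀ s ∈ G, ∃ X Y, M.IsVerticalPartition X s Y) : ∃ c, M.HasLobes L G c := by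
  have key : ∀ s ∈ G, ∃ t, M.IsLobe L s t := by
    intro s hs
    obtain rfl | hxs := eq_or_ne x s
    · exact ⟨t, hl⟩
    obtain ⟨s', hs', hne⟩ : ∃ s' ∈ G, s' ∉ ({x, s} : Set α) := by
      by_contra! hcon
      have := hG3.trans (encard_le_encard hcon)
      rw [encard_pair hxs] at this
      norm_num at this
    simp only [mem_insert_iff, mem_singleton_iff, not_or] at hne
    obtain ⟨X, Y, h1⟩ := hv s hs
    obtain ⟨X', Y', h2⟩ := hv s' hs'
    exact (hl.lobes hM h4 hL (hG hx) (hG hs) (hG hs') hxs (Ne.symm hne.1) (Ne.symm hne.2)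
      h1 h2).1
  choose! c hc using key
  exact ⟨c, hL, hG, hG3, hc⟩

lemma HasMinor.exists_isRankMinor_of_contract (h : (M ／ {x}).HasMinor N) (hx : x ∈ M.E) :
    ∃ f I, M.IsRankMinor N f I ∧ x ∈ I := by
  obtain ⟨f, I, h⟩ := h.exists_isRankMinor
  exact ⟨f, I ∪ {x}, h.of_contract (singleton_subset_iff.2 hx), by simp⟩

lemma IsRankMinor.encard_le (h : M.IsRankMinor N f I) (hN : N.NConnected 3)
    (hN4 : 4 ≤ N.E.encard) : N.E.encard ≤ M.E.encard := by
  rw [← (h.injOn fun e he e' he' hne ↦ hN.finRk_pair hN4 he he' hne).encard_image]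
  exact encard_le_encard h.image_subset

/-- If no contraction of an element of the cocircuit `C` keeping an `N`-minor is `3`-connected up
to parallel pairs, then some line meeting `C` has a lobe and can be contracted keeping an
`N`-minor. -/
lemma IsRankMinor.exists_isLobe (h : M.IsRankMinor N f I) (hM : M.NConnected 3)
    (h4 : 4 ≤ M.E.encard) (hN : N.NConnected 3) (hN4 : 4 ≤ N.E.encard) (hC : M.IsCocircuit C)
    (hx : x ∈ C) (hxI : x ∈ I)
    (hvC : ∀ x ∈ C, (∃ f I, M.IsRankMinor N f I ∧ x ∈ I) → ∃ X Y, M.IsVerticalPartition X x Y) :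
    4 ≤ M.finRk M.E ∧ ∃ L x t f I, M.IsLongLine L ∧ x ∈ L ∧ x ∈ C ∧ M.IsLobe L x t ∧
      M.IsRankMinor N f I ∧ L ⊆ I := by
  obtain ⟨X, Y, hv⟩ := hvC x hx ⟨f, I, h, hxI⟩
  obtain ⟨X, z, Y, hmin, hgood⟩ := h.exists_isMinimalPartition hM h4 hN hN4 hx hxI hv
  obtain ⟨L, x, t, hL, hLY, hxL, hxC, hl⟩ := hmin.exists_isLobe hM h4 hC
    fun y hy hyC ↦ hvC y hyC (hgood y (mem_insert_of_mem _ hy))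
  obtain ⟨f, I, h, hxI⟩ := hgood x (hLY hxL)
  obtain ⟨f, I, h, hLI⟩ := hl.exists_isRankMinor h hM h4 hN hN4 hL hxL hxI
  have h1 := hv.left_rank
  have h2 := hv.right_rank
  have h3 := hv.rank_add
  exact ⟨by omega, L, x, t, f, I, hL, hxL, hxC, hl, h, hLI⟩

lemma IsLobe.isFourFan {s : α} (hl : M.IsLobe {x, e, s} x t) (hM : M.NConnected 3)
    (h4 : 4 ≤ M.E.encard) (hL : M.IsLongLine {x, e, s}) (hxe : x ≠ e) (hxs : x ≠ s)
    (hes : e ≠ s) : M.IsFourFan x e s t := by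
  have ht := hl.notMem
  simp only [mem_insert_iff, mem_singleton_iff, not_or] at ht
  obtain ⟨htx, hte, hts⟩ := ht
  have h3 : ({x, e, s} : Set α).encard = 3 := encard_eq_three.2 ⟨x, e, s, hxe, hxs, hes, rfl⟩
  have hT : ({x, e, s} : Set α) \ {x} ∪ {t} = {e, s, t} := by grind
  refine ⟨?_, hL.isTriangle hM h4 subset_rfl h3, hT ▸ hl.isCocircuit, ?_⟩
  · simp only [List.nodup_cons, List.mem_cons, List.not_mem_nil, or_false, not_or,
      not_false_eq_true, List.nodup_nil, and_true]
    exact ⟨⟨hxe, hxs, Ne.symm htx⟩, ⟨hes, Ne.symm hte⟩, Ne.symm hts⟩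
  · exact encard_eq_three.2 ⟨e, s, t, hes, Ne.symm hte, Ne.symm hts, rfl⟩

end main

end Matroid

theorem mainTheorem1 {α : Type*} {β : Type*} (M : Matroid α) [M.Finite] (N : Matroid β) [N.Finite]
    (hM : M.NConnected 3) (hN : N.NConnected 3) (hN4 : 4 ≤ N.E.encard)
    (C : Set α) (hC : M.IsCocircuit C)
    (hx₀ : ∃ x₀ ∈ C, (M ／ {x₀}).HasMinor N) :
    (∃ x ∈ C, (M ／ {x}).si.NConnected 3 ∧ (M ／ {x}).si.HasMinor N) ∨
    (∃ x₁ x₂ x₃ x₄, M.IsFourFan x₁ x₂ x₃ x₄ ∧ x₁ ∈ C ∧ x₃ ∈ C ∧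
      (M ／ {x₂}).si.NConnected 3 ∧ (M ／ {x₂}).si.HasMinor N) ∨
    (∃ L K y, M.IsSegmentCosegmentPair L K y ∧ L ⊆ C ∧
      (∃ e, M.closure L \ L = {e} ∧ e ∉ C ∧
        (M ／ {e}).si.NConnected 3 ∧ (M ／ {e}).si.HasMinor N) ∧
      (M ／ M.closure L).NConnected 3 ∧ (M ／ M.closure L).HasMinor N ∧
      ∀ x ∈ L, (M ／ {x}).ConnectedUpToUniqueSpore (M.closure L \ {x}) (y x)) ∨
    (∃ L K y, M.IsSegmentCosegmentPair L K y ∧ M.IsFlat L ∧ (L \ C).encard ≤ 1 ∧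
      (M ／ L).NConnected 3 ∧ (M ／ L).HasMinor N ∧
      ∀ x ∈ L, (M ／ {x}).ConnectedUpToUniqueSpore (L \ {x}) (y x)) := by
  obtain ⟨x₀, hx₀C, hx₀N⟩ := hx₀
  have hCE := hC.subset_ground
  obtain ⟨f₀, I₀, h₀, hx₀I⟩ := hx₀N.exists_isRankMinor_of_contract (hCE hx₀C)
  have h4 : 4 ≤ M.E.encard := hN4.trans (h₀.encard_le hN hN4)
  rw [or_iff_not_imp_left]
  intro hno
  have hvC : ∀ x ∈ C, (∃ f I, M.IsRankMinor N f I ∧ x ∈ I) →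
      ∃ X Y, M.IsVerticalPartition X x Y := by
    rintro x hx ⟨f, I, h, hxI⟩
    exact hM.exists_isVerticalPartition h4 (hCE hx) fun hsi ↦
      hno ⟨x, hx, hsi, h.hasMinor_si_contract hN hN4 (singleton_subset_iff.2 hxI)⟩
  obtain ⟨hr, L, x, t, f, I, hL, hxL, hxC, hl, h, hLI⟩ :=
    h₀.exists_isLobe hM h4 hN hN4 hC hx₀C hx₀I hvC
  have hLC : ∀ s ∈ L, s ∈ C → ∃ X Y, M.IsVerticalPartition X s Y := fun s hs hsC ↦
    hvC s hsC ⟨f, I, h, hLI hs⟩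
  have hLN := h.hasMinor_contract hN hN4 hLI
  by_cases hall : ∀ s ∈ L, ∃ X Y, M.IsVerticalPartition X s Y
  · obtain ⟨c, hc⟩ := hl.exists_hasLobes hM h4 hL subset_rfl hL.card hxL hall
    refine .inr (.inr ⟨L, c '' L, c, hc.isSegmentCosegmentPair hM h4 (by omega),
      Matroid.isFlat_iff_closure_eq.2 (hc.closure_subset_eq hM h4),
      Set.encard_le_one_iff_subsingleton.2 fun e he e' he' ↦
        hL.eq_of_notMem hM h4 hC hxL hxC he he', hc.nConnected_contract hM, hLN,
      fun s hs ↦ hc.connectedUpToUniqueSpore hM h4 hr hs⟩)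
  push Not at hall
  obtain ⟨e, heL, hev⟩ := hall
  have heC : e ∉ C := fun heC ↦ by
    obtain ⟨X, Y, hv⟩ := hLC e heL heC
    exact hev X Y hv
  have hGC : L \ {e} ⊆ C := fun s hs ↦ by
    by_contra hsC
    exact hs.2 (hL.eq_of_notMem hM h4 hC hxL hxC ⟨hs.1, hsC⟩ ⟨heL, heC⟩)
  have hesi : (M ／ {e}).si.NConnected 3 := by
    by_contra hcon
    obtain ⟨X, Y, hv⟩ := hM.exists_isVerticalPartition h4 (hL.subset_ground heL) hcon
    exact hev X Y hv
  have heN := h.hasMinor_si_contract hN hN4 (singleton_subset_iff.2 (hLI heL))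
  have hxe : x ≠ e := fun hxe ↦ heC (hxe ▸ hxC)
  by_cases hG3 : 3 ≤ (L \ {e}).encard
  · obtain ⟨c, hc⟩ := hl.exists_hasLobes hM h4 hL sdiff_subset hG3 ⟨hxL, hxe⟩
      fun s hs ↦ hLC s hs.1 (hGC hs)
    have hcl := hc.closure_subset_eq hM h4
    refine .inr (.inl ⟨L \ {e}, c '' (L \ {e}), c, hc.isSegmentCosegmentPair hM h4 (by omega),
      hGC, ⟨e, ?_, heC, hesi, heN⟩, ?_, ?_, ?_⟩)
    · rw [hcl, sdiff_sdiff_cancel_left (singleton_subset_iff.2 heL)]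
    · rw [hcl]; exact hc.nConnected_contract hM
    · rwa [hcl]
    · rw [hcl]; exact fun s hs ↦ hc.connectedUpToUniqueSpore hM h4 hr hs
  -- Only two points of `L` differ from `e`, so `L` is a triangle, and the lobe at `x` supplies the
  -- triad of the fan.
  · obtain ⟨s, hs, hsx, hse⟩ := hL.exists_ne x e
    have hLeq : L = {x, e, s} := by
      refine subset_antisymm (fun a ha ↦ ?_) (insert_subset hxL (pair_subset heL hs))
      by_contra hcon
      simp only [mem_insert_iff, mem_singleton_iff, not_or] at hcon
      refine hG3 ?_
      rw [← encard_eq_three.2 ⟨x, s, a, hsx.symm, Ne.symm hcon.1, Ne.symm hcon.2.2, rfl⟩]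
      exact encard_le_encard (by grind)
    subst hLeq
    exact .inl ⟨x, e, s, t, hl.isFourFan hM h4 hL hxe hsx.symm hse.symm, hxC, hGC ⟨hs, hse⟩,
      hesi, heN⟩
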